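/- Let $M=[l,r]$ with $l<r$, or $M=\mathbf T=\mathbf R/\mathbf Z$; put $\partial M=\{l,r\}$ in the first case and $\partial M=\emptyset$ in the second. Let $F\in C(\mathbf R)$ be nonnegative with $F(v)=0$ if and only if $v=1$ (F1), and $\liminf_{|v|\to\infty}F(v)>0$ (F2). Let $a\in M\setminus\partial M$ and $b\ge 0$. For $\varepsilon>0$ and $v\in H^1(M)\subset C(M)$ set \[ E^\varepsilon_{\mathrm{sMM},b}(v)=\frac{\varepsilon}{2}\int_M\Bigl|\frac{dv}{dx}\Bigr|^2dx+\frac1{2\varepsilon}\int_M F(v)\,dx+b\,v(a)^2,\qquad G(v)=\Bigl|\int_1^v\sqrt{F(\tau)}\,d\tau\Bigr| . \] Let $\mathcal B$ be the set of set-valued functions $\Gamma$ on $M$, with values subsets of $\mathbf R$, whose graph $\{(x,y): x\in M,\ y\in\Gamma(x)\}$ is compact in $M\times\mathbf R$. Let $\mathcal A_0$ be the set of $\Gamma\in\mathcal B$ such that every $\Gamma(x)$ is a nonempty closed interval and $\Gamma(x)=\{1\}$ for all but countably many $x$. For $v_\varepsilon\in C(M)$ and $\Xi\in\mathcal B$ write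 $v_\varepsilon\xrightarrow{g}\Xi$ if the graph of $v_\varepsilon$ converges to the graph of $\Xi$ in the Hausdorff distance of $M\times\mathbf R$ as $\varepsilon\downarrow0$. For $\Xi\in\mathcal A_0$ let $\Sigma$ be the (countable) set of points $x_i$ at which $\Xi(x_i)=[\xi_i^-,\xi_i^+]$ with $\xi_i^-<\xi_i^+$, let $\kappa_i=1$ if $x_i\in\partial M$ and $\kappa_i=0$ otherwise, and set \[ E^0_{\mathrm{sMM}}(\Xi,M)=\sum_{x_i\in\Sigma}\Bigl\{2\bigl(G(\xi_i^-)+G(\xi_i^+)\bigr)-\kappa_i\max\bigl(G(\xi_i^-),G(\xi_i^+)\bigr)\Bigr\}\in[0,\infty]; \] set $E^0_{\mathrm{sMM}}(\Xi,M)=\infty$ for $\Xi\in\mathcal B\setminus\mathcal A_0$. Let $E^0_{\mathrm{sMM},b}(\Xi,M)=E^0_{\mathrm{sMM}}(\Xi,M)+b\,(\min\Xi(a))^2$. Then: (i) (liminf inequality) Let $v_\varepsilon\in H^1(M)$ for $0<\varepsilon<1$ and $v_\varepsilon\xrightarrow{g}\Xi\in\mathcal B$. If $b=0$ or $\min\Xi(a)\ge0$,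 then \[ E^0_{\mathrm{sMM},b}(\Xi,M)\le\liminf_{\varepsilon\to0}E^\varepsilon_{\mathrm{sMM},b}(v_\varepsilon). \] Moreover (without a sign condition on $\Xi(a)$), if $\liminf_{\varepsilon\to0}E^\varepsilon_{\mathrm{sMM},b}(v_\varepsilon)<\infty$, then $\Xi\in\mathcal A_0$. (ii) (limsup inequality) For every $\Xi\in\mathcal A_0$ there are $w_\varepsilon\in H^1(M)$, $0<\varepsilon<1$, such that $w_\varepsilon\xrightarrow{g}\Xi$ and \[ \lim_{\varepsilon\to0}E^\varepsilon_{\mathrm{sMM},b}(w_\varepsilon)=E^0_{\mathrm{sMM},b}(\Xi,M)\in[0,\infty]. \] -/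

import Mathlib

namespace SMM

open MeasureTheory Filter Topology
open scoped ENNReal

noncomputable section

/-! ### Set-valued functions and graph convergence -/

section SetValued

variable {M : Type*} [MetricSpace M]

/-- The graph of a set-valued function, in `M × ℝ` with the distance
`(d_M(x, x')² + |y - y'|²)^{1/2}`. -/
def graph (Γ : M → Set ℝ) : Set (WithLp 2 (M × ℝ)) :=
  {z | z.snd ∈ Γ z.fst}

/-- The set-valued function `x ↦ {g x}` of a continuous function `g`. -/
def single (g : C(M, ℝ)) : M → Set ℝ := fun x => {g x}

/-- The class `𝓑` of bounded upper semicontinuous set-valued functions. -/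
def classB (M : Type*) [MetricSpace M] : Set (M → Set ℝ) :=
  {Γ | IsCompact (graph Γ)}

/-- The class `𝓐` of those `Γ ∈ 𝓑` all of whose values are (nonempty) closed intervals. -/
def classA (M : Type*) [MetricSpace M] : Set (M → Set ℝ) :=
  {Γ | Γ ∈ classB M ∧ ∀ x, ∃ p q : ℝ, p ≤ q ∧ Γ x = Set.Icc p q}

/-- The class `𝓐₀` of those `Γ ∈ 𝓐` with `Γ x = {1}` for all but countably many `x`. -/
def classA₀ (M : Type*) [MetricSpace M] : Set (M → Set ℝ) :=
  {Γ | Γ ∈ classA M ∧ {x | Γ x ≠ {1}}.Countable}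

/-- Graph convergence `v_ε → Ξ` as `ε ↓ 0`. The Hausdorff distance is taken in `[0, ∞]`,
so that a nonempty graph is at distance `∞` from an empty one. -/
def GraphTendsto (v : ℝ → C(M, ℝ)) (Ξ : M → Set ℝ) : Prop :=
  Tendsto (fun ε => Metric.hausdorffEDist (graph (single (v ε))) (graph Ξ)) (𝓝[>] 0) (𝓝 0)

/-- The set `Σ` of exceptional points: those where the value is a nontrivial interval. -/
def exceptional (Ξ : M → Set ℝ) : Set M := {x | (Ξ x).Nontrivial}

end SetValued

/-! ### The one-dimensional domains -/

/-- The domain `M`: a closed bounded interval `[l, r]` with `l < r`, or the circle `ℝ / ℤ`. -/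
inductive Domain : Type
  | interval (l r : ℝ) (h : l < r) : Domain
  | circle : Domain

namespace Domain

/-- The points of `M`. -/
def Pt : Domain → Type
  | interval l r _ => Set.Icc l r
  | circle => UnitAddCircle

instance instMetricSpace : (D : Domain) → MetricSpace D.Pt
  | interval l r _ => inferInstanceAs (MetricSpace (Set.Icc l r))
  | circle => inferInstanceAs (MetricSpace UnitAddCircle)

/-- Left end of the parameter interval of `M` (`[l, r]`, respectively `[0, 1]`). -/
def left : Domain → ℝ
  | interval l _ _ => l
  | circle => 0

/-- Right end of the parameter interval of `M`. -/
def right : Domain → ℝ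
  | interval _ r _ => r
  | circle => 1

/-- The coordinate `[left, right] → M`: the identity of `[l, r]` (its values outside `[l, r]`
play no role), respectively the quotient map `[0, 1] → ℝ / ℤ`. -/
def param : (D : Domain) → ℝ → D.Pt
  | interval l r h => Set.projIcc l r h.le
  | circle => fun x => (x : UnitAddCircle)

/-- The boundary of `M`: the two end points, respectively empty. -/
def boundary : (D : Domain) → Set D.Pt
  | interval l r _ => {x : Set.Icc l r | (x : ℝ) = l ∨ (x : ℝ) = r}
  | circle => ∅

end Domain

/-! ### The functionals -/

/-- `v ∈ H¹(M)`: in the coordinate of `M`, the continuous function `v` is absolutely continuous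
with square integrable derivative. -/
def MemH1 (D : Domain) (v : C(D.Pt, ℝ)) : Prop :=
  AbsolutelyContinuousOnInterval (fun x => v (D.param x)) D.left D.right ∧
    MemLp (deriv fun x => v (D.param x)) 2 (volume.restrict (Set.Ioo D.left D.right))

/-- The single-well Modica–Mortola functional. -/
def energy (D : Domain) (F : ℝ → ℝ) (ε : ℝ) (v : C(D.Pt, ℝ)) : ℝ :=
  ε / 2 * (∫ x in D.left..D.right, |deriv (fun x => v (D.param x)) x| ^ 2) +
    1 / (2 * ε) * ∫ x in D.left..D.right, F (v (D.param x))

/-- The functional with the additional term `b v(a)²`. -/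
def energyB (D : Domain) (F : ℝ → ℝ) (a : D.Pt) (b ε : ℝ) (v : C(D.Pt, ℝ)) : ℝ :=
  energy D F ε v + b * v a ^ 2

/-- `G(v) = |∫₁ᵛ √F|`. -/
def G (F : ℝ → ℝ) (v : ℝ) : ℝ := |∫ τ in (1 : ℝ)..v, √(F τ)|

/-- `κ = 1` at the boundary points of `M` and `κ = 0` elsewhere. -/
def kappa (D : Domain) : D.Pt → ℝ := D.boundary.indicator 1

open Classical in
/-- The limit functional: a sum over the exceptional points `x`, where
`ξ⁻ = min (Ξ x)` and `ξ⁺ = max (Ξ x)`, if `Ξ ∈ 𝓐₀`, and `∞` otherwise. -/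
def limitEnergy (D : Domain) (F : ℝ → ℝ) (Ξ : D.Pt → Set ℝ) : ℝ≥0∞ :=
  if Ξ ∈ classA₀ D.Pt then
    ∑' x : exceptional Ξ,
      ENNReal.ofReal
        (2 * (G F (sInf (Ξ x)) + G F (sSup (Ξ x))) -
          kappa D x * max (G F (sInf (Ξ x))) (G F (sSup (Ξ x))))
  else ∞

/-- The limit functional with the additional term `b (min Ξ(a))²`. -/
def limitEnergyB (D : Domain) (F : ℝ → ℝ) (a : D.Pt) (b : ℝ) (Ξ : D.Pt → Set ℝ) : ℝ≥0∞ :=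
  limitEnergy D F Ξ + ENNReal.ofReal (b * sInf (Ξ a) ^ 2)

/-- Condition (F1): `F` is continuous, nonnegative, and vanishes exactly at `1`. -/
def CondF1 (F : ℝ → ℝ) : Prop :=
  Continuous F ∧ (∀ v, 0 ≤ F v) ∧ ∀ v, F v = 0 ↔ v = 1

/-- Condition (F2): `liminf_{|v| → ∞} F v > 0`. -/
def CondF2 (F : ℝ → ℝ) : Prop :=
  0 < liminf (fun v => (F v : EReal)) (cocompact ℝ)

end

end SMM

/-!
In the liminf inequality, `a² + b² ≥ 2ab` bounds the energy of `v_ε` on an open set from below by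
the variation there of `∫₁^{v_ε} √F`. Near an interior point `x`, graph convergence makes `v_ε`
come close to `min Ξ(x)` and to `max Ξ(x)` and be close to `1` on both sides of `x`; whatever the
order in which the extremes are visited, the variation is in the limit at least `2 (G (min Ξ(x)) +
G (max Ξ(x)))`. At a boundary point only one side is available, and one passage between `1` and an
extreme is saved. Disjoint neighbourhoods of finitely many points give the sum. A finite energy
bound also confines `Ξ(x)` to `{1}` off a countable set, since each value other than `1` costs a
positive amount.

For the limsup inequality finitely many values of `Ξ` are recovered up to a small error by bumps
following the profile `q' = √H(q)`, for which `a² + b² ≥ 2ab` is nearly an equality; here `H`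
exceeds `F` by a small constant, so that the profile reaches `1` in finite time. Two bumps serve
one point `x`: the one at `x` reaches one end of `Ξ(x)`, the other end is reached by a bump
nearby. As the graph of `Ξ` is compact, finitely many points suffice for any given accuracy, and a
diagonal choice gives the recovery family.
-/

namespace SMM

open MeasureTheory Filter Topology
open scoped ENNReal

section GraphConvergence

variable {M : Type*} [MetricSpace M] {v : ℝ → C(M, ℝ)} {Ξ : M → Set ℝ}

/-- The graphs of `u` and `Ξ` lie in the `ρ`-neighbourhood of each other. Neighbourhoods are taken
for the maximum distance of `M × ℝ`, which defines the same convergence as the Euclidean one. -/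
def GraphsNear (ρ : ℝ) (u : M → ℝ) (Ξ : M → Set ℝ) : Prop :=
  (∀ p, ∃ x, ∃ y ∈ Ξ x, dist p x < ρ ∧ dist (u p) y < ρ) ∧
    ∀ x, ∀ y ∈ Ξ x, ∃ p, dist p x < ρ ∧ dist (u p) y < ρ

lemma dist_ofLp_le (z w : WithLp 2 (M × ℝ)) : dist z.ofLp w.ofLp ≤ dist z w := by
  simpa using (WithLp.prod_lipschitzWith_ofLp 2 M ℝ).dist_le_mul z w

lemma dist_le_two_mul_dist_ofLp (z w : WithLp 2 (M × ℝ)) :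
    dist z w ≤ 2 * dist z.ofLp w.ofLp := by
  refine ((WithLp.prod_antilipschitzWith_ofLp 2 M ℝ).le_mul_dist z w).trans ?_
  gcongr
  exact_mod_cast (NNReal.rpow_le_rpow_of_exponent_le one_le_two (by norm_num)).trans
    (NNReal.rpow_one 2).le

lemma graphsNear_of_hausdorffEDist_lt {ρ : ℝ} {u : C(M, ℝ)}
    (h : Metric.hausdorffEDist (graph (single u)) (graph Ξ) < ENNReal.ofReal ρ) :
    GraphsNear ρ u Ξ := by
  have hρ : 0 < ρ := ENNReal.ofReal_pos.1 (pos_of_gt h)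
  refine ⟨fun p => ?_, fun x y hy => ?_⟩
  · obtain ⟨z, hz, hd⟩ := Metric.exists_edist_lt_of_hausdorffEDist_lt
      (x := WithLp.toLp 2 (p, u p)) (show _ ∈ graph (single u) from rfl) h
    rw [edist_lt_ofReal] at hd
    exact ⟨z.fst, z.snd, hz, max_lt_iff.1 ((dist_ofLp_le _ _).trans_lt hd)⟩
  · rw [Metric.hausdorffEDist_comm] at h
    obtain ⟨z, hz, hd⟩ := Metric.exists_edist_lt_of_hausdorffEDist_lt
      (x := WithLp.toLp 2 (x, y)) (show _ ∈ graph Ξ from hy) h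
    rw [edist_comm, edist_lt_ofReal] at hd
    have hz : z.snd = u z.fst := hz
    exact ⟨z.fst, hz ▸ max_lt_iff.1 ((dist_ofLp_le _ _).trans_lt hd)⟩

lemma GraphsNear.hausdorffEDist_le {ρ : ℝ} {u : C(M, ℝ)} (h : GraphsNear ρ u Ξ) :
    Metric.hausdorffEDist (graph (single u)) (graph Ξ) ≤ ENNReal.ofReal (2 * ρ) := by
  have key (z w : WithLp 2 (M × ℝ)) (hfst : dist z.fst w.fst < ρ) (hsnd : dist z.snd w.snd < ρ) :
      edist z w ≤ ENNReal.ofReal (2 * ρ) := by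
    rw [edist_dist]
    refine ENNReal.ofReal_le_ofReal ((dist_le_two_mul_dist_ofLp z w).trans ?_)
    gcongr
    exact max_le hfst.le hsnd.le
  refine Metric.hausdorffEDist_le_of_mem_edist (fun z hz => ?_) fun z hz => ?_
  · obtain ⟨x, y, hy, hx, hd⟩ := h.1 z.fst
    have hz : z.snd = u z.fst := hz
    exact ⟨WithLp.toLp 2 (x, y), hy, key _ _ hx (hz ▸ hd)⟩
  · obtain ⟨p, hp, hd⟩ := h.2 z.fst z.snd hz
    exact ⟨WithLp.toLp 2 (p, u p), rfl, edist_comm z _ ▸ key _ _ hp hd⟩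

lemma graphTendsto_iff :
    GraphTendsto v Ξ ↔ ∀ ρ > 0, ∀ᶠ ε in 𝓝[>] (0 : ℝ), GraphsNear ρ (v ε) Ξ := by
  refine ⟨fun h ρ hρ => ?_, fun h => ENNReal.tendsto_nhds_zero.2 fun δ hδ => ?_⟩
  · filter_upwards [h.eventually_lt_const (ENNReal.ofReal_pos.2 hρ)] with ε hε
    exact graphsNear_of_hausdorffEDist_lt hε
  · obtain ⟨ρ, hρ, hρδ⟩ : ∃ ρ : ℝ, 0 < ρ ∧ ENNReal.ofReal (2 * ρ) ≤ δ := by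
      obtain ⟨r, hr, hrδ⟩ := ENNReal.lt_iff_exists_nnreal_btwn.1 hδ
      refine ⟨r / 2, by simpa using hr, ?_⟩
      rw [mul_div_cancel₀ _ two_ne_zero, ENNReal.ofReal_coe_nnreal]
      exact hrδ.le
    filter_upwards [h ρ hρ] with ε hε
    exact hε.hausdorffEDist_le.trans hρδ

lemma isCompact_setOf_mem_of_mem_classB (hΞ : Ξ ∈ classB M) :
    IsCompact {z : M × ℝ | z.2 ∈ Ξ z.1} := by
  convert IsCompact.image hΞ (f := WithLp.ofLp) (by fun_prop) using 1
  ext z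
  exact ⟨fun hz => ⟨WithLp.toLp 2 z, hz, rfl⟩, by rintro ⟨w, hw, rfl⟩; exact hw⟩

lemma exists_abs_le_of_mem_classB (hΞ : Ξ ∈ classB M) : ∃ R, ∀ x, ∀ y ∈ Ξ x, |y| ≤ R := by
  obtain ⟨R, hR⟩ := ((isCompact_setOf_mem_of_mem_classB hΞ).image
    continuous_snd).isBounded.exists_norm_le
  exact ⟨R, fun x y hy => hR y ⟨(x, y), hy, rfl⟩⟩

lemma isCompact_of_mem_classB (hΞ : Ξ ∈ classB M) (x : M) : IsCompact (Ξ x) := by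
  obtain ⟨R, hR⟩ := exists_abs_le_of_mem_classB hΞ
  refine (isCompact_Icc (a := -R) (b := R)).of_isClosed_subset ?_ fun y hy => abs_le.1 (hR x y hy)
  exact (isCompact_setOf_mem_of_mem_classB hΞ).isClosed.preimage (by fun_prop : Continuous
    fun y : ℝ => (x, y))

lemma GraphTendsto.mem_of_frequently (h : GraphTendsto v Ξ) (hΞ : Ξ ∈ classB M) {x : M} {y : ℝ}
    (hy : ∀ ρ > 0, ∃ᶠ ε in 𝓝[>] (0 : ℝ), ∃ p, dist p x < ρ ∧ dist (v ε p) y < ρ) : y ∈ Ξ x := by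
  suffices (x, y) ∈ closure {z : M × ℝ | z.2 ∈ Ξ z.1} by
    rwa [(isCompact_setOf_mem_of_mem_classB hΞ).isClosed.closure_eq] at this
  refine Metric.mem_closure_iff.2 fun ρ hρ => ?_
  obtain ⟨ε, ⟨p, hpx, hpy⟩, hε⟩ := ((hy (ρ / 2) (half_pos hρ)).and_eventually
    (graphTendsto_iff.1 h (ρ / 2) (half_pos hρ))).exists
  obtain ⟨x', y', hy', hx', hd'⟩ := hε.1 p
  refine ⟨(x', y'), hy', max_lt ?_ ?_⟩
  · linarith [dist_triangle_left x x' p]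
  · linarith [dist_triangle_left y y' (v ε p)]

lemma GraphTendsto.exists_eventually_abs_le (h : GraphTendsto v Ξ) (hΞ : Ξ ∈ classB M) :
    ∃ R, ∀ᶠ ε in 𝓝[>] (0 : ℝ), ∀ x, |v ε x| ≤ R := by
  obtain ⟨R, hR⟩ := exists_abs_le_of_mem_classB hΞ
  refine ⟨R + 1, ?_⟩
  filter_upwards [graphTendsto_iff.1 h 1 one_pos] with ε hε p
  obtain ⟨x, y, hy, -, hd⟩ := hε.1 p
  rw [Real.dist_eq] at hd
  linarith [hR x y hy, abs_sub_abs_le_abs_sub (v ε p) y]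

lemma GraphTendsto.eventually_mem (h : GraphTendsto v Ξ) (hΞ : Ξ ∈ classB M) {x : M} {U : Set ℝ}
    (hU : IsOpen U) (hx : Ξ x ⊆ U) : ∀ᶠ ε in 𝓝[>] (0 : ℝ), v ε x ∈ U := by
  by_contra hcon
  obtain ⟨R, hR⟩ := h.exists_eventually_abs_le hΞ
  obtain ⟨y, hy, hyc⟩ := (isCompact_Icc.diff hU : IsCompact (Set.Icc (-R) R \ U))
    |>.exists_mapClusterPt_of_frequently (f := fun ε => v ε x)
      ((not_eventually.1 hcon).and_eventually hR |>.mono fun ε hε => ⟨abs_le.1 (hε.2 x), hε.1⟩)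
  refine hy.2 (hx (h.mem_of_frequently hΞ fun ρ hρ => ?_))
  exact (hyc.frequently (Metric.ball_mem_nhds y hρ)).mono fun ε hε => ⟨x, by simpa using hρ, hε⟩

end GraphConvergence

namespace Domain

/-- The real coordinates of points of `M`: the interval `[l, r]`, respectively all of `ℝ`, as the
coordinate `param` of the circle may run through its universal cover. -/
def coordSet : Domain → Set ℝ
  | interval l r _ => Set.Icc l r
  | circle => Set.univ

variable (D : Domain)

lemma left_lt_right : D.left < D.right :=
  match D with
  | interval _ _ h => h
  | circle => zero_lt_one

lemma lipschitzWith_param : LipschitzWith 1 D.param := by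
  cases D with
  | interval l r h => exact LipschitzWith.projIcc h.le
  | circle =>
    refine LipschitzWith.of_dist_le_mul fun s t => ?_
    change dist (s : UnitAddCircle) (t : UnitAddCircle) ≤ _
    rw [dist_eq_norm, ← AddCircle.coe_sub, UnitAddCircle.norm_eq]
    simpa [Real.dist_eq] using round_le (s - t) 0

lemma dist_param_le (s t : ℝ) : dist (D.param s) (D.param t) ≤ dist s t := by
  simpa using D.lipschitzWith_param.dist_le_mul s t

lemma continuous_param : Continuous D.param := D.lipschitzWith_param.continuous

lemma ordConnected_coordSet : D.coordSet.OrdConnected :=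
  match D with
  | interval _ _ _ => Set.ordConnected_Icc
  | circle => Set.ordConnected_univ

lemma Icc_subset_coordSet : Set.Icc D.left D.right ⊆ D.coordSet :=
  match D with
  | interval _ _ _ => subset_rfl
  | circle => Set.subset_univ _

lemma exists_lift {s : ℝ} (hs : s ∈ D.coordSet) (y : D.Pt) :
    ∃ t ∈ D.coordSet, D.param t = y ∧ dist t s ≤ dist y (D.param s) := by
  cases D with
  | interval l r h =>
    refine ⟨(y : Set.Icc l r).1, (y : Set.Icc l r).2, Set.projIcc_val h.le y, ?_⟩
    change _ ≤ dist (y : Set.Icc l r) (Set.projIcc l r h.le s)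
    rw [Set.projIcc_of_mem h.le hs]
    rfl
  | circle =>
    obtain ⟨t, rfl⟩ := QuotientAddGroup.mk_surjective (y : UnitAddCircle)
    refine ⟨t - round (t - s), trivial, ?_, ?_⟩
    · change ((t - round (t - s) : ℝ) : UnitAddCircle) = (t : UnitAddCircle)
      rw [AddCircle.coe_sub, sub_eq_self]
      simp
    · change |_| ≤ dist (t : UnitAddCircle) (s : UnitAddCircle)
      rw [dist_eq_norm (t : UnitAddCircle), ← AddCircle.coe_sub, UnitAddCircle.norm_eq,
        sub_right_comm]

lemma exists_coord (x : D.Pt) : ∃ s ∈ D.coordSet, D.param s = x := by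
  obtain ⟨t, ht, htx, -⟩ :=
    D.exists_lift (D.Icc_subset_coordSet (Set.left_mem_Icc.2 D.left_lt_right.le)) x
  exact ⟨t, ht, htx⟩

lemma injOn_param (s : ℝ) : Set.InjOn D.param (D.coordSet ∩ Set.Ioc s (s + 1)) := by
  intro t ht u hu htu
  cases D with
  | interval l r h =>
    exact (Set.strictMonoOn_projIcc h.le).injOn ht.1 hu.1 htu
  | circle =>
    have : Fact ((0 : ℝ) < 1) := ⟨one_pos⟩
    exact (AddCircle.coe_eq_coe_iff_of_mem_Ioc (p := (1 : ℝ)) ht.2 hu.2).1 htu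

lemma nontrivial_coordSet : D.coordSet.Nontrivial :=
  ⟨D.left, D.Icc_subset_coordSet (Set.left_mem_Icc.2 D.left_lt_right.le),
    D.right, D.Icc_subset_coordSet (Set.right_mem_Icc.2 D.left_lt_right.le), D.left_lt_right.ne⟩

lemma exists_ne_mem_coordSet {s ρ : ℝ} (hs : s ∈ D.coordSet) (hρ : 0 < ρ) :
    ∃ t ∈ D.coordSet ∩ Metric.ball s ρ, t ≠ s := by
  have hacc := D.ordConnected_coordSet.isPreconnected.preperfect_of_nontrivial
    D.nontrivial_coordSet s hs
  obtain ⟨t, ⟨htρ, ht⟩, hts⟩ := accPt_iff_nhds.1 hacc _ (Metric.ball_mem_nhds s hρ)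
  exact ⟨t, ⟨ht, htρ⟩, hts⟩

lemma exists_lt_lt_mem_coordSet {s : ℝ} (hs : s ∈ D.coordSet) (hb : D.param s ∉ D.boundary) :
    (∃ t ∈ D.coordSet, t < s) ∧ ∃ t ∈ D.coordSet, s < t := by
  cases D with
  | interval l r h =>
    have hs : s ∈ Set.Icc l r := hs
    have hb : ¬((Set.projIcc l r h.le s : ℝ) = l ∨ (Set.projIcc l r h.le s : ℝ) = r) := hb
    rw [Set.projIcc_of_mem h.le hs, not_or] at hb
    exact ⟨⟨l, Set.left_mem_Icc.2 h.le, hs.1.lt_of_ne' hb.1⟩,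
      r, Set.right_mem_Icc.2 h.le, hs.2.lt_of_ne hb.2⟩
  | circle => exact ⟨⟨s - 1, trivial, sub_one_lt s⟩, s + 1, trivial, lt_add_one s⟩

end Domain

section classA₀

variable {D : Domain} {Ξ : D.Pt → Set ℝ} {s t ρ : ℝ}

lemma exists_mem_Ioo_eq_one (hΞ : Ξ ∈ classA₀ D.Pt) (hs : s ∈ D.coordSet) (ht : t ∈ D.coordSet)
    (hst : s < t) : ∃ u ∈ D.coordSet ∩ Set.Ioo s t, Ξ (D.param u) = {1} := by
  by_contra! hcon
  set I := Set.Ioo s (min t (s + 1))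
  have hI : I ⊆ D.coordSet ∩ Set.Ioo s t := fun u hu => by
    have hut := hu.2.trans_le (min_le_left t (s + 1))
    exact ⟨D.ordConnected_coordSet.out hs ht ⟨hu.1.le, hut.le⟩, hu.1, hut⟩
  have hI' : I ⊆ D.coordSet ∩ Set.Ioc s (s + 1) := fun u hu =>
    ⟨(hI hu).1, hu.1, hu.2.le.trans (min_le_right _ _)⟩
  have himage : D.param '' I ⊆ {x | Ξ x ≠ {1}} :=
    Set.image_subset_iff.2 fun u hu => hcon u (hI hu)
  have hcount : I.Countable :=
    Set.countable_of_injective_of_countable_image ((D.injOn_param s).mono hI')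
      (hΞ.2.mono himage)
  exact (Cardinal.Real.Ioo_countable_iff.1 hcount).not_gt (lt_min hst (lt_add_one s))

lemma exists_gt_eq_one (hΞ : Ξ ∈ classA₀ D.Pt) (hs : s ∈ D.coordSet) (ht : t ∈ D.coordSet)
    (hst : s < t) (hρ : 0 < ρ) :
    ∃ β ∈ D.coordSet ∩ Metric.ball s ρ, s < β ∧ Ξ (D.param β) = {1} := by
  obtain ⟨β, ⟨hβ, hsβ, hβt⟩, hβ1⟩ := exists_mem_Ioo_eq_one hΞ hs (t := min t (s + ρ))
    (D.ordConnected_coordSet.out hs ht ⟨by simp [hst.le, hρ.le], min_le_left _ _⟩)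
    (by simp [hst, hρ])
  refine ⟨β, ⟨hβ, ?_⟩, hsβ, hβ1⟩
  rw [Metric.mem_ball, Real.dist_eq, abs_of_pos (sub_pos.2 hsβ)]
  linarith [hβt.trans_le (min_le_right t (s + ρ))]

lemma exists_lt_eq_one (hΞ : Ξ ∈ classA₀ D.Pt) (hs : s ∈ D.coordSet) (ht : t ∈ D.coordSet)
    (hts : t < s) (hρ : 0 < ρ) :
    ∃ α ∈ D.coordSet ∩ Metric.ball s ρ, α < s ∧ Ξ (D.param α) = {1} := by
  obtain ⟨α, ⟨hα, htα, hαs⟩, hα1⟩ := exists_mem_Ioo_eq_one hΞ (s := max t (s - ρ)) (t := s)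
    (D.ordConnected_coordSet.out ht hs ⟨le_max_left _ _, by simp [hts.le, hρ.le]⟩) hs
    (by simp [hts, hρ])
  refine ⟨α, ⟨hα, ?_⟩, hαs, hα1⟩
  rw [Metric.mem_ball', Real.dist_eq, abs_of_pos (sub_pos.2 hαs)]
  linarith [(le_max_right t (s - ρ)).trans_lt htα]

lemma exists_ne_eq_one (hΞ : Ξ ∈ classA₀ D.Pt) (hs : s ∈ D.coordSet) (hρ : 0 < ρ) :
    ∃ β ∈ D.coordSet ∩ Metric.ball s ρ, β ≠ s ∧ Ξ (D.param β) = {1} := by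
  obtain ⟨t, ⟨ht, -⟩, hts⟩ := D.exists_ne_mem_coordSet hs hρ
  rcases lt_or_gt_of_ne hts with hts | hst
  · obtain ⟨α, hα, hαs, hα1⟩ := exists_lt_eq_one hΞ hs ht hts hρ
    exact ⟨α, hα, hαs.ne, hα1⟩
  · obtain ⟨β, hβ, hsβ, hβ1⟩ := exists_gt_eq_one hΞ hs ht hst hρ
    exact ⟨β, hβ, hsβ.ne', hβ1⟩

lemma one_mem_of_mem_classA₀ (hΞ : Ξ ∈ classA₀ D.Pt) (x : D.Pt) : (1 : ℝ) ∈ Ξ x := by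
  obtain ⟨s, hs, rfl⟩ := D.exists_coord x
  suffices (D.param s, (1 : ℝ)) ∈ closure {z : D.Pt × ℝ | z.2 ∈ Ξ z.1} by
    rwa [(isCompact_setOf_mem_of_mem_classB hΞ.1.1).isClosed.closure_eq] at this
  refine Metric.mem_closure_iff.2 fun ρ hρ => ?_
  obtain ⟨β, ⟨-, hβ⟩, -, hβ1⟩ := exists_ne_eq_one hΞ hs hρ
  refine ⟨(D.param β, 1), hβ1.ge rfl, ?_⟩
  simpa [Prod.dist_eq, hρ] using (D.dist_param_le s β).trans_lt (Metric.mem_ball'.1 hβ)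

lemma eq_Icc_of_mem_classA₀ (hΞ : Ξ ∈ classA₀ D.Pt) (x : D.Pt) :
    Ξ x = Set.Icc (sInf (Ξ x)) (sSup (Ξ x)) := by
  obtain ⟨p, q, hpq, h⟩ := hΞ.1.2 x
  rw [h, csInf_Icc hpq, csSup_Icc hpq]

lemma sInf_le_one (hΞ : Ξ ∈ classA₀ D.Pt) (x : D.Pt) : sInf (Ξ x) ≤ 1 :=
  csInf_le (isCompact_of_mem_classB hΞ.1.1 x).bddBelow (one_mem_of_mem_classA₀ hΞ x)

lemma one_le_sSup (hΞ : Ξ ∈ classA₀ D.Pt) (x : D.Pt) : 1 ≤ sSup (Ξ x) :=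
  le_csSup (isCompact_of_mem_classB hΞ.1.1 x).bddAbove (one_mem_of_mem_classA₀ hΞ x)

end classA₀

section PrimitiveOfSqrt

variable {F : ℝ → ℝ}

/-- The signed primitive `∫₁ʸ √F`, so that `G = |primG|`. -/
noncomputable def primG (F : ℝ → ℝ) (y : ℝ) : ℝ := ∫ τ in (1 : ℝ)..y, √(F τ)

lemma abs_primG (F : ℝ → ℝ) (y : ℝ) : |primG F y| = G F y := rfl

@[simp] lemma primG_one (F : ℝ → ℝ) : primG F 1 = 0 := intervalIntegral.integral_same

lemma primG_nonneg (F : ℝ → ℝ) {y : ℝ} (hy : 1 ≤ y) : 0 ≤ primG F y :=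
  intervalIntegral.integral_nonneg hy fun _ _ => Real.sqrt_nonneg _

lemma primG_nonpos (F : ℝ → ℝ) {y : ℝ} (hy : y ≤ 1) : primG F y ≤ 0 := by
  rw [primG, intervalIntegral.integral_symm]
  exact neg_nonpos.2 (intervalIntegral.integral_nonneg hy fun _ _ => Real.sqrt_nonneg _)

lemma abs_primG_sub_primG {y z : ℝ} (hy : y ≤ 1) (hz : 1 ≤ z) :
    |primG F y - primG F z| = G F y + G F z := by
  have hy' := primG_nonpos F hy
  have hz' := primG_nonneg F hz
  rw [← abs_primG, ← abs_primG, abs_of_nonpos hy', abs_of_nonneg hz', abs_of_nonpos (by linarith)]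
  ring

lemma hasDerivAt_primG (hF : Continuous F) (y : ℝ) : HasDerivAt (primG F) (√(F y)) y :=
  hF.sqrt.integral_hasStrictDerivAt 1 y |>.hasDerivAt

lemma contDiff_primG (hF : Continuous F) : ContDiff ℝ 1 (primG F) := by
  have hderiv : deriv (primG F) = fun y => √(F y) := funext fun y => (hasDerivAt_primG hF y).deriv
  exact contDiff_one_iff_deriv.2
    ⟨fun y => (hasDerivAt_primG hF y).differentiableAt, hderiv ▸ hF.sqrt⟩

lemma strictMono_primG (hF : CondF1 F) : StrictMono (primG F) := fun y z hyz => by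
  have hc : Continuous fun τ => √(F τ) := hF.1.sqrt
  have hpos {τ : ℝ} (hτ : τ ≠ 1) : 0 < √(F τ) :=
    Real.sqrt_pos.2 ((hF.2.1 τ).lt_of_ne' (mt (hF.2.2 τ).1 hτ))
  rw [← sub_pos, primG, primG, intervalIntegral.integral_interval_sub_left
    (hc.intervalIntegrable _ _) (hc.intervalIntegrable _ _)]
  refine intervalIntegral.integral_pos hyz hc.continuousOn (fun _ _ => Real.sqrt_nonneg _) ?_
  rcases eq_or_ne y 1 with rfl | hy
  · exact ⟨z, Set.right_mem_Icc.2 hyz.le, hpos hyz.ne'⟩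
  · exact ⟨y, Set.left_mem_Icc.2 hyz.le, hpos hy⟩

lemma G_nonneg (F : ℝ → ℝ) (y : ℝ) : 0 ≤ G F y := abs_nonneg _

@[simp] lemma G_one (F : ℝ → ℝ) : G F 1 = 0 := by simp [G]

end PrimitiveOfSqrt

lemma absolutelyContinuousOnInterval_comp_contDiff {f g : ℝ → ℝ} {s t : ℝ}
    (hg : ContDiff ℝ 1 g) (hf : AbsolutelyContinuousOnInterval f s t) :
    AbsolutelyContinuousOnInterval (fun x => g (f x)) s t := by
  obtain ⟨R, hR⟩ := hf.exists_bound
  obtain ⟨K, hK⟩ := (hg.contDiffOn (s := Set.Icc (-R) R)).exists_lipschitzOnWith (by decide)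
    (convex_Icc _ _) isCompact_Icc
  have hmem {x : ℝ} (hx : x ∈ Set.uIcc s t) : f x ∈ Set.Icc (-R) R := abs_le.1 (hR x hx)
  rw [absolutelyContinuousOnInterval_iff] at hf ⊢
  intro ε hε
  obtain ⟨δ, hδ, h⟩ := hf (ε / (K + 1)) (by positivity)
  refine ⟨δ, hδ, fun E hE hlen => ?_⟩
  calc ∑ i ∈ Finset.range E.1, dist (g (f (E.2 i).1)) (g (f (E.2 i).2))
      ≤ ∑ i ∈ Finset.range E.1, (K + 1) * dist (f (E.2 i).1) (f (E.2 i).2) :=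
        Finset.sum_le_sum fun i hi =>
          (hK.dist_le_mul _ (hmem (hE.1 i hi).1) _ (hmem (hE.1 i hi).2)).trans
            (by gcongr; exact le_add_of_nonneg_right zero_le_one)
    _ = (K + 1) * ∑ i ∈ Finset.range E.1, dist (f (E.2 i).1) (f (E.2 i).2) := by
        rw [Finset.mul_sum]
    _ < (K + 1) * (ε / (K + 1)) := by gcongr; exact h E hE hlen
    _ = ε := mul_div_cancel₀ _ (by positivity)

lemma sqrt_mul_abs_le {ε : ℝ} (hε : 0 < ε) {p y : ℝ} (hy : 0 ≤ y) :
    √y * |p| ≤ ε / 2 * |p| ^ 2 + 1 / (2 * ε) * y := by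
  have hsq : ε / 2 * |p| ^ 2 + 1 / (2 * ε) * √y ^ 2 - √y * |p| =
      1 / (2 * ε) * (ε * |p| - √y) ^ 2 := by field_simp; ring
  have hnonneg : 0 ≤ 1 / (2 * ε) * (ε * |p| - √y) ^ 2 := by positivity
  rw [Real.sq_sqrt hy] at hsq
  linarith

lemma edist_primG_le_lintegral (hF : Continuous F) (hF0 : ∀ y, 0 ≤ F y) {f : ℝ → ℝ} {s t ε : ℝ}
    (hε : 0 < ε) (hst : s ≤ t) (hf : AbsolutelyContinuousOnInterval f s t) :
    edist (primG F (f s)) (primG F (f t)) ≤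
      ∫⁻ x in Set.Ioc s t, ENNReal.ofReal (ε / 2 * |deriv f x| ^ 2 + 1 / (2 * ε) * F (f x)) := by
  have hac := absolutelyContinuousOnInterval_comp_contDiff (contDiff_primG hF) hf
  rw [edist_comm, edist_eq_enorm_sub, ← hac.integral_deriv_eq_sub,
    intervalIntegral.integral_of_le hst]
  refine (enorm_integral_le_lintegral_enorm _).trans (lintegral_mono_ae ?_)
  filter_upwards [ae_restrict_of_ae hf.ae_differentiableAt, ae_restrict_mem measurableSet_Ioc]
    with x hx hxs
  have hdiff : DifferentiableAt ℝ f x :=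
    hx (Set.uIcc_of_le hst ▸ Set.Ioc_subset_Icc_self hxs)
  have hcomp : HasDerivAt (fun x => primG F (f x)) (√(F (f x)) * deriv f x) x :=
    (hasDerivAt_primG hF (f x)).comp x hdiff.hasDerivAt
  rw [hcomp.deriv, ← ofReal_norm, Real.norm_eq_abs, abs_mul, abs_of_nonneg (Real.sqrt_nonneg _)]
  exact ENNReal.ofReal_le_ofReal (sqrt_mul_abs_le hε (hF0 _))

section Density

variable {D : Domain} {F : ℝ → ℝ} {ε : ℝ} {v : C(D.Pt, ℝ)}

/-- The integrand of `energy` in the coordinate of `M`, as a function with values in `[0, ∞]`. -/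
noncomputable def density (D : Domain) (F : ℝ → ℝ) (ε : ℝ) (v : C(D.Pt, ℝ)) (x : ℝ) : ℝ≥0∞ :=
  ENNReal.ofReal (ε / 2 * |deriv (fun x => v (D.param x)) x| ^ 2 +
    1 / (2 * ε) * F (v (D.param x)))

/-- The part of the energy carried by a subset `U` of `M`. -/
noncomputable def localEnergy (D : Domain) (F : ℝ → ℝ) (ε : ℝ) (v : C(D.Pt, ℝ))
    (U : Set D.Pt) : ℝ≥0∞ :=
  ∫⁻ x in D.param ⁻¹' U ∩ Set.Ioc D.left D.right, density D F ε v x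

lemma periodic_param_circle : Function.Periodic Domain.circle.param 1 :=
  AddCircle.coe_add_period 1

lemma periodic_deriv {f : ℝ → ℝ} {T : ℝ} (hf : Function.Periodic f T) :
    Function.Periodic (deriv f) T := fun x => by
  rw [← deriv_comp_add_const, show (fun y => f (y + T)) = f from funext hf]

lemma periodic_density_circle (F : ℝ → ℝ) (ε : ℝ) (v : C(Domain.circle.Pt, ℝ)) :
    Function.Periodic (density Domain.circle F ε v) 1 := fun x => by
  have hderiv := periodic_deriv (periodic_param_circle.comp v) x
  simp only [Function.comp_def] at hderiv
  simp only [density, hderiv, periodic_param_circle x]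

lemma setLIntegral_Ioc_add_int {E : ℝ → ℝ≥0∞} (hE : Function.Periodic E 1) (s t : ℝ) (n : ℤ) :
    ∫⁻ x in Set.Ioc (s + n) (t + n), E x = ∫⁻ x in Set.Ioc s t, E x := by
  have hshift := (measurePreserving_add_right (volume : Measure ℝ) (n : ℝ))
    |>.setLIntegral_comp_preimage_emb (MeasurableEquiv.addRight (n : ℝ)).measurableEmbedding E
      (Set.Ioc (s + n) (t + n))
  have hpre : (fun x : ℝ => x + n) ⁻¹' Set.Ioc (s + n) (t + n) = Set.Ioc s t := by simp
  rw [← hshift, hpre]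
  exact lintegral_congr fun x => by simpa using hE.int_mul n x

lemma setLIntegral_Ioc_add_one_eq {E : ℝ → ℝ≥0∞} (hE : Function.Periodic E 1) (s t : ℝ) :
    ∫⁻ x in Set.Ioc s (s + 1), E x = ∫⁻ x in Set.Ioc t (t + 1), E x := by
  have hlift (u : ℝ) : ∫⁻ x in Set.Ioc u (u + 1), E x = ∫⁻ b : UnitAddCircle, hE.lift b :=
    UnitAddCircle.lintegral_preimage u hE.lift
  rw [hlift, hlift]

lemma setLIntegral_density_le_localEnergy (D : Domain) (F : ℝ → ℝ) (ε : ℝ) (v : C(D.Pt, ℝ))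
    {s t : ℝ} (hs : s ∈ D.coordSet) (ht : t ∈ D.coordSet) (hst : t ≤ s + 1) {U : Set D.Pt}
    (hUo : IsOpen U) (hU : ∀ x ∈ Set.Ioc s t, D.param x ∈ U) :
    ∫⁻ x in Set.Ioc s t, density D F ε v x ≤ localEnergy D F ε v U := by
  cases D with
  | interval l r h =>
    exact lintegral_mono_set fun x hx => ⟨hU x hx, hs.1.trans_lt hx.1, hx.2.trans ht.2⟩
  | circle =>
    set V := Domain.circle.param ⁻¹' U
    set E := V.indicator (density Domain.circle F ε v)
    have hE : Function.Periodic E 1 := fun x => by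
      have hV : x + 1 ∈ V ↔ x ∈ V := by simp only [V, Set.mem_preimage, periodic_param_circle x]
      by_cases hx : x ∈ V
      · simp only [E, Set.indicator_of_mem, hV, hx, periodic_density_circle F ε v x]
      · simp only [E, Set.indicator_of_notMem, hV, hx, not_false_eq_true]
    calc ∫⁻ x in Set.Ioc s t, density Domain.circle F ε v x
        = ∫⁻ x in Set.Ioc s t, E x :=
          setLIntegral_congr_fun measurableSet_Ioc fun x hx =>
            (Set.indicator_of_mem (show x ∈ V from hU x hx) _).symm
      _ ≤ ∫⁻ x in Set.Ioc s (s + 1), E x := lintegral_mono_set (Set.Ioc_subset_Ioc_right hst)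
      _ = ∫⁻ x in Set.Ioc 0 (0 + 1), E x := setLIntegral_Ioc_add_one_eq hE s 0
      _ = localEnergy Domain.circle F ε v U := by
          rw [setLIntegral_indicator (hUo.preimage Domain.circle.continuous_param).measurableSet,
            zero_add]
          rfl

lemma energy_nonneg (hF0 : ∀ y, 0 ≤ F y) (hε : 0 < ε) (v : C(D.Pt, ℝ)) :
    0 ≤ energy D F ε v := by
  have hderiv : 0 ≤ ∫ x in D.left..D.right, |deriv (fun x => v (D.param x)) x| ^ 2 :=
    intervalIntegral.integral_nonneg D.left_lt_right.le fun _ _ => by positivity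
  have hpot : 0 ≤ ∫ x in D.left..D.right, F (v (D.param x)) :=
    intervalIntegral.integral_nonneg D.left_lt_right.le fun _ _ => hF0 _
  unfold energy
  positivity

lemma ofReal_energy (hF : Continuous F) (hF0 : ∀ y, 0 ≤ F y) (hε : 0 < ε) (hv : MemH1 D v) :
    ENNReal.ofReal (energy D F ε v) = ∫⁻ x in Set.Ioc D.left D.right, density D F ε v x := by
  have hderiv : IntervalIntegrable (fun x => |deriv (fun x => v (D.param x)) x| ^ 2) volume
      D.left D.right :=
    (intervalIntegrable_iff_integrableOn_Ioo_of_le D.left_lt_right.le).2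
      (hv.2.integrable_norm_pow two_ne_zero)
  have hpot : IntervalIntegrable (fun x => F (v (D.param x))) volume D.left D.right :=
    (hF.comp (v.continuous.comp D.continuous_param)).intervalIntegrable _ _
  have hsum := (hderiv.const_mul (ε / 2)).add (hpot.const_mul (1 / (2 * ε)))
  rw [energy, ← intervalIntegral.integral_const_mul, ← intervalIntegral.integral_const_mul,
    ← intervalIntegral.integral_add (hderiv.const_mul _) (hpot.const_mul _),
    intervalIntegral.integral_of_le D.left_lt_right.le, ofReal_integral_eq_lintegral_ofReal]
  · rfl
  · exact (intervalIntegrable_iff_integrableOn_Ioc_of_le D.left_lt_right.le).1 hsum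
  · refine ae_of_all _ fun x => ?_
    have := hF0 (v (D.param x))
    simp only [Pi.zero_apply]
    positivity

lemma localEnergy_le_energy (hF : Continuous F) (hF0 : ∀ y, 0 ≤ F y) (hε : 0 < ε)
    (hv : MemH1 D v) (U : Set D.Pt) :
    localEnergy D F ε v U ≤ ENNReal.ofReal (energy D F ε v) := by
  rw [ofReal_energy hF hF0 hε hv]
  exact lintegral_mono_set Set.inter_subset_right

lemma sum_localEnergy_le_energy (hF : Continuous F) (hF0 : ∀ y, 0 ≤ F y) (hε : 0 < ε)
    (hv : MemH1 D v) {T : Finset D.Pt} {U : D.Pt → Set D.Pt} (hU : ∀ x, IsOpen (U x))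
    (hd : (T : Set D.Pt).PairwiseDisjoint U) :
    ∑ x ∈ T, localEnergy D F ε v (U x) ≤ ENNReal.ofReal (energy D F ε v) := by
  have hmeas (x : D.Pt) : MeasurableSet (D.param ⁻¹' U x ∩ Set.Ioc D.left D.right) :=
    ((hU x).preimage D.continuous_param).measurableSet.inter measurableSet_Ioc
  simp only [localEnergy]
  rw [ofReal_energy hF hF0 hε hv,
    ← lintegral_biUnion_finset (fun x hx y hy hxy => ?_) fun x _ => hmeas x]
  · exact lintegral_mono_set (Set.iUnion₂_subset fun x _ => Set.inter_subset_right)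
  · exact ((hd hx hy hxy).preimage D.param).mono Set.inter_subset_left Set.inter_subset_left

lemma energy_le_energyB {b : ℝ} (hb : 0 ≤ b) (a : D.Pt) (ε : ℝ) (v : C(D.Pt, ℝ)) :
    energy D F ε v ≤ energyB D F a b ε v :=
  le_add_of_nonneg_right (by positivity)

lemma ofReal_energyB {b : ℝ} (hF0 : ∀ y, 0 ≤ F y) (hε : 0 < ε) (hb : 0 ≤ b) (a : D.Pt)
    (v : C(D.Pt, ℝ)) : ENNReal.ofReal (energyB D F a b ε v) =
      ENNReal.ofReal (energy D F ε v) + ENNReal.ofReal (b * v a ^ 2) :=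
  ENNReal.ofReal_add (energy_nonneg hF0 hε v) (by positivity)

end Density

section Variation

variable {D : Domain} {F : ℝ → ℝ} {ε : ℝ} {v : C(D.Pt, ℝ)}

/-- The variation of `g ∘ u` in the coordinates within distance `ρ` of `s`. For `g = primG F`
it bounds the local energy from below, which reduces the liminf inequality to statements about
graph convergence alone. -/
noncomputable def localVariation (D : Domain) (g : ℝ → ℝ) (u : D.Pt → ℝ) (s ρ : ℝ) : ℝ≥0∞ :=
  eVariationOn (fun t => g (u (D.param t))) (D.coordSet ∩ Metric.ball s ρ)

lemma edist_primG_le_lintegral_density_of_mem_Icc (hF : Continuous F) (hF0 : ∀ y, 0 ≤ F y)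
    (hε : 0 < ε) (hv : MemH1 D v) {s t : ℝ} (hs : D.left ≤ s) (hst : s ≤ t) (ht : t ≤ D.right) :
    edist (primG F (v (D.param s))) (primG F (v (D.param t))) ≤
      ∫⁻ x in Set.Ioc s t, density D F ε v x :=
  edist_primG_le_lintegral hF hF0 hε hst <| hv.1.mono <| by
    rw [Set.uIcc_of_le hst, Set.uIcc_of_le D.left_lt_right.le]
    exact Set.Icc_subset_Icc hs ht

lemma edist_primG_le_lintegral_density (hF : Continuous F) (hF0 : ∀ y, 0 ≤ F y)
    (hε : 0 < ε) (hv : MemH1 D v) {s t : ℝ} (hs : s ∈ D.coordSet) (ht : t ∈ D.coordSet)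
    (hst : s ≤ t) (hts : t ≤ s + 1) :
    edist (primG F (v (D.param s))) (primG F (v (D.param t))) ≤
      ∫⁻ x in Set.Ioc s t, density D F ε v x := by
  cases D with
  | interval l r h => exact edist_primG_le_lintegral_density_of_mem_Icc hF hF0 hε hv hs.1 hst ht.2
  | circle =>
    have hcell (n : ℤ) {s t : ℝ} (hns : n ≤ s) (hst : s ≤ t) (htn : t ≤ n + 1) :
        edist (primG F (v (Domain.circle.param s))) (primG F (v (Domain.circle.param t))) ≤
          ∫⁻ x in Set.Ioc s t, density Domain.circle F ε v x := by
      have hper (x : ℝ) : Domain.circle.param (x - n) = Domain.circle.param x := by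
        simpa using periodic_param_circle.sub_int_mul_eq n (x := x)
      have hunit := edist_primG_le_lintegral_density_of_mem_Icc hF hF0 hε hv
        (s := s - n) (t := t - n) (sub_nonneg.2 hns) (by linarith) (sub_le_iff_le_add'.2 htn)
      rw [hper, hper, ← setLIntegral_Ioc_add_int (periodic_density_circle F ε v) _ _ n] at hunit
      simpa using hunit
    have hs₀ := Int.floor_le s
    have hs₁ := Int.lt_floor_add_one s
    rcases le_total t (⌊s⌋ + 1) with h | h
    · exact hcell ⌊s⌋ hs₀ hst h
    · rw [← Set.Ioc_union_Ioc_eq_Ioc hs₁.le h,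
        lintegral_union measurableSet_Ioc (Set.Ioc_disjoint_Ioc_of_le le_rfl)]
      exact (edist_triangle _ _ _).trans (add_le_add (hcell ⌊s⌋ hs₀ hs₁.le le_rfl)
        (hcell (⌊s⌋ + 1) (by simp) h (by push_cast; linarith)))

lemma eVariationOn_le_of_edist_le_lintegral {f : ℝ → ℝ} {J : Set ℝ} {E : ℝ → ℝ≥0∞} {X : ℝ≥0∞}
    (hf : ∀ s ∈ J, ∀ t ∈ J, s ≤ t → edist (f s) (f t) ≤ ∫⁻ x in Set.Ioc s t, E x)
    (hX : ∀ s ∈ J, ∀ t ∈ J, ∫⁻ x in Set.Ioc s t, E x ≤ X) : eVariationOn f J ≤ X := by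
  refine iSup_le fun ⟨n, u, hu, hJ⟩ => ?_
  have hsum (n : ℕ) : ∑ i ∈ Finset.range n, edist (f (u (i + 1))) (f (u i)) ≤
      ∫⁻ x in Set.Ioc (u 0) (u n), E x := by
    induction n with
    | zero => simp
    | succ n ih =>
      rw [Finset.sum_range_succ, ← Set.Ioc_union_Ioc_eq_Ioc (hu n.zero_le) (hu n.le_succ),
        lintegral_union measurableSet_Ioc (Set.Ioc_disjoint_Ioc_of_le le_rfl), edist_comm]
      exact add_le_add ih (hf _ (hJ n) _ (hJ (n + 1)) (hu n.le_succ))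
  exact (hsum n).trans (hX _ (hJ 0) _ (hJ n))

lemma localVariation_primG_le_localEnergy (hF : Continuous F) (hF0 : ∀ y, 0 ≤ F y) (hε : 0 < ε)
    (hv : MemH1 D v) {s ρ : ℝ} (hρ : ρ ≤ 1 / 2) {U : Set D.Pt} (hUo : IsOpen U)
    (hU : ∀ t ∈ Metric.ball s ρ, D.param t ∈ U) :
    localVariation D (primG F) v s ρ ≤ localEnergy D F ε v U := by
  have hlen {t u : ℝ} (ht : t ∈ Metric.ball s ρ) (hu : u ∈ Metric.ball s ρ) : u ≤ t + 1 := by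
    rw [Real.ball_eq_Ioo] at ht hu
    linarith [ht.1, hu.2]
  refine eVariationOn_le_of_edist_le_lintegral
    (fun t ht u hu htu =>
      edist_primG_le_lintegral_density hF hF0 hε hv ht.1 hu.1 htu (hlen ht.2 hu.2))
    fun t ht u hu => setLIntegral_density_le_localEnergy D F ε v ht.1 hu.1 (hlen ht.2 hu.2) hUo
      fun x hx => hU x ?_
  rw [Real.ball_eq_Ioo] at ht hu ⊢
  exact ⟨ht.2.1.trans hx.1, hx.2.trans_lt hu.2.2⟩

variable {f : ℝ → ℝ} {J : Set ℝ} {α β p q : ℝ}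

lemma edist_add_edist_le_eVariationOn (hα : α ∈ J) (hp : p ∈ J) (hβ : β ∈ J) (hαp : α ≤ p)
    (hpβ : p ≤ β) : edist (f α) (f p) + edist (f p) (f β) ≤ eVariationOn f J := by
  rw [← eVariationOn.pair, ← eVariationOn.pair]
  refine (eVariationOn.add_le_union f ?_).trans (eVariationOn.mono f ?_)
  · simp [hαp, hpβ, hαp.trans hpβ]
  · simp [Set.insert_subset_iff, hα, hp, hβ]

lemma edist_add_edist_add_edist_le_eVariationOn (hα : α ∈ J) (hp : p ∈ J) (hq : q ∈ J)
    (hβ : β ∈ J) (hαp : α ≤ p) (hpq : p ≤ q) (hqβ : q ≤ β) :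
    edist (f α) (f p) + edist (f p) (f q) + edist (f q) (f β) ≤ eVariationOn f J := by
  rw [← eVariationOn.pair f q]
  refine (add_le_add_left (edist_add_edist_le_eVariationOn (J := {α, p, q}) ?_ ?_ ?_ hαp hpq)
    _).trans ((eVariationOn.add_le_union f ?_).trans (eVariationOn.mono f ?_))
  · simp
  · simp
  · simp
  · simp [hqβ, hpq, hαp.trans hpq, hpq.trans hqβ, (hαp.trans hpq).trans hqβ]
  · simp [Set.insert_subset_iff, hα, hp, hq, hβ]

lemma ofReal_abs_sub_le_eVariationOn (hp : p ∈ J) (hq : q ∈ J) :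
    ENNReal.ofReal |f p - f q| ≤ eVariationOn f J := by
  rw [← Real.dist_eq, ← edist_dist]
  exact eVariationOn.edist_le f hp hq

lemma ofReal_abs_sub_add_min_le_eVariationOn (hp : p ∈ J) (hq : q ∈ J) (hβ : β ∈ J)
    (h : p ≤ β ∧ q ≤ β ∨ β ≤ p ∧ β ≤ q) :
    ENNReal.ofReal (|f p - f q| + min |f p| |f q| - |f β|) ≤ eVariationOn f J := by
  wlog hpq : p ≤ q generalizing p q
  · rw [abs_sub_comm, min_comm]
    exact this hq hp (h.imp And.symm And.symm) (le_of_not_ge hpq)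
  rcases h with h | h
  · refine le_trans ?_ (edist_add_edist_le_eVariationOn (f := f) hp hq hβ hpq h.2)
    rw [edist_dist, edist_dist, ← ENNReal.ofReal_add dist_nonneg dist_nonneg]
    refine ENNReal.ofReal_le_ofReal ?_
    rw [Real.dist_eq, Real.dist_eq]
    linarith [abs_sub_abs_le_abs_sub (f q) (f β), min_le_right |f p| |f q|]
  · refine le_trans ?_ (edist_add_edist_le_eVariationOn (f := f) hβ hp hq h.1 hpq)
    rw [edist_dist, edist_dist, ← ENNReal.ofReal_add dist_nonneg dist_nonneg]
    refine ENNReal.ofReal_le_ofReal ?_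
    rw [dist_comm (f β), Real.dist_eq, Real.dist_eq]
    linarith [abs_sub_abs_le_abs_sub (f p) (f β), min_le_left |f p| |f q|]

lemma ofReal_abs_sub_add_add_le_eVariationOn (hα : α ∈ J) (hp : p ∈ J) (hq : q ∈ J) (hβ : β ∈ J)
    (hαp : α ≤ p) (hαq : α ≤ q) (hpβ : p ≤ β) (hqβ : q ≤ β) :
    ENNReal.ofReal (|f p - f q| + (|f p| + |f q|) - (|f α| + |f β|)) ≤ eVariationOn f J := by
  wlog hpq : p ≤ q generalizing p q
  · rw [abs_sub_comm, add_comm |f p|]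
    exact this hq hp hαq hαp hqβ hpβ (le_of_not_ge hpq)
  refine le_trans ?_
    (edist_add_edist_add_edist_le_eVariationOn (f := f) hα hp hq hβ hαp hpq hqβ)
  rw [edist_dist, edist_dist, edist_dist, ← ENNReal.ofReal_add dist_nonneg dist_nonneg,
    ← ENNReal.ofReal_add (by positivity) dist_nonneg]
  refine ENNReal.ofReal_le_ofReal ?_
  rw [dist_comm (f α), Real.dist_eq, Real.dist_eq, Real.dist_eq]
  linarith [abs_sub_abs_le_abs_sub (f p) (f α), abs_sub_abs_le_abs_sub (f q) (f β)]

end Variation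

section LocalLowerBound

variable {D : Domain} {F : ℝ → ℝ} {Ξ : D.Pt → Set ℝ} {v : ℝ → C(D.Pt, ℝ)}

lemma exists_tendsto_zero_of_forall_eventually {α : Type*} [Nonempty α] {f : ℝ → α → ℝ≥0∞}
    (h : ∀ δ > 0, ∀ᶠ ε in 𝓝[>] (0 : ℝ), ∃ x, f ε x ≤ δ) :
    ∃ x : ℝ → α, Tendsto (fun ε => f ε (x ε)) (𝓝[>] 0) (𝓝 0) := by
  have hnear (ε : ℝ) (hε : 0 < ε) : ∃ x, f ε x ≤ (⨅ x, f ε x) + ENNReal.ofReal ε := by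
    rcases eq_or_ne (⨅ x, f ε x) ⊤ with htop | htop
    · exact ⟨Classical.arbitrary α, by simp [htop]⟩
    · obtain ⟨x, hx⟩ := iInf_lt_iff.1
        (ENNReal.lt_add_right htop (ENNReal.ofReal_pos.2 hε).ne')
      exact ⟨x, hx.le⟩
  choose! x hx using hnear
  have hinf : Tendsto (fun ε => ⨅ x, f ε x) (𝓝[>] 0) (𝓝 0) :=
    ENNReal.tendsto_nhds_zero.2 fun δ hδ =>
      (h δ hδ).mono fun ε ⟨y, hy⟩ => (iInf_le _ y).trans hy
  have hε : Tendsto ENNReal.ofReal (𝓝[>] 0) (𝓝 0) := by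
    simpa using (ENNReal.continuous_ofReal.tendsto 0).mono_left nhdsWithin_le_nhds
  refine ⟨x, tendsto_of_tendsto_of_tendsto_of_le_of_le' tendsto_const_nhds
    (by simpa using hinf.add hε) (Eventually.of_forall fun _ => zero_le) ?_⟩
  filter_upwards [self_mem_nhdsWithin] with ε hε using hx ε hε

lemma GraphTendsto.exists_tendsto_lift (h : GraphTendsto v Ξ) {s : ℝ} (hs : s ∈ D.coordSet)
    {y : ℝ} (hy : y ∈ Ξ (D.param s)) :
    ∃ p : ℝ → ℝ, (∀ ε, p ε ∈ D.coordSet) ∧ Tendsto p (𝓝[>] 0) (𝓝 s) ∧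
      Tendsto (fun ε => v ε (D.param (p ε))) (𝓝[>] 0) (𝓝 y) := by
  have : Nonempty D.coordSet := ⟨s, hs⟩
  obtain ⟨p, hp⟩ := exists_tendsto_zero_of_forall_eventually
    (f := fun ε (t : D.coordSet) => edist ((t : ℝ), v ε (D.param t)) (s, y)) fun δ hδ => by
      obtain ⟨r, hr, hrδ⟩ := ENNReal.lt_iff_exists_nnreal_btwn.1 hδ
      filter_upwards [graphTendsto_iff.1 h r (by simpa using hr)] with ε hε
      obtain ⟨x, hx, hd⟩ := hε.2 _ _ hy
      obtain ⟨t, ht, rfl, hts⟩ := D.exists_lift hs x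
      refine ⟨⟨t, ht⟩, (?_ : _ ≤ (r : ℝ≥0∞)).trans hrδ.le⟩
      rw [edist_le_coe, ← NNReal.coe_le_coe, coe_nndist]
      exact max_le (hts.trans hx.le) hd.le
  have hlim : Tendsto (fun ε => ((p ε : ℝ), v ε (D.param (p ε)))) (𝓝[>] 0) (𝓝 (s, y)) :=
    tendsto_iff_edist_tendsto_0.2 hp
  exact ⟨fun ε => p ε, fun ε => (p ε).2, hlim.fst_nhds, hlim.snd_nhds⟩

lemma GraphTendsto.tendsto_of_eq_singleton (h : GraphTendsto v Ξ) (hΞ : Ξ ∈ classB D.Pt)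
    {x : D.Pt} {y : ℝ} (hx : Ξ x = {y}) : Tendsto (fun ε => v ε x) (𝓝[>] 0) (𝓝 y) :=
  (nhds_basis_opens y).tendsto_right_iff.2 fun _ hU =>
    h.eventually_mem hΞ hU.2 (by simpa [hx] using hU.1)

lemma ofReal_le_liminf_of_tendsto {ι : Type*} {l : Filter ι} {c : ι → ℝ} {X : ι → ℝ≥0∞} {c₀ : ℝ}
    [l.NeBot] (hc : Tendsto c l (𝓝 c₀)) (h : ∀ᶠ i in l, ENNReal.ofReal (c i) ≤ X i) :
    ENNReal.ofReal c₀ ≤ liminf X l :=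
  (ENNReal.tendsto_ofReal hc).liminf_eq.ge.trans (liminf_le_liminf h)

variable {g : ℝ → ℝ} {s ρ y z : ℝ}

lemma ofReal_abs_sub_le_liminf_localVariation (hg : Continuous g) (h : GraphTendsto v Ξ)
    (hs : s ∈ D.coordSet) (hρ : 0 < ρ) (hy : y ∈ Ξ (D.param s)) (hz : z ∈ Ξ (D.param s)) :
    ENNReal.ofReal |g y - g z| ≤ liminf (fun ε => localVariation D g (v ε) s ρ) (𝓝[>] 0) := by
  obtain ⟨p, hpD, hps, hpy⟩ := h.exists_tendsto_lift hs hy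
  obtain ⟨q, hqD, hqs, hqz⟩ := h.exists_tendsto_lift hs hz
  refine ofReal_le_liminf_of_tendsto
    (((hg.tendsto y).comp hpy).sub ((hg.tendsto z).comp hqz)).abs ?_
  filter_upwards [hps (Metric.ball_mem_nhds s hρ), hqs (Metric.ball_mem_nhds s hρ)] with ε hp hq
  exact ofReal_abs_sub_le_eVariationOn ⟨hpD ε, hp⟩ ⟨hqD ε, hq⟩

lemma ofReal_abs_sub_add_min_le_liminf_localVariation (hg : Continuous g) (hg1 : g 1 = 0)
    (h : GraphTendsto v Ξ) (hΞ : Ξ ∈ classA₀ D.Pt) (hs : s ∈ D.coordSet) (hρ : 0 < ρ)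
    (hy : y ∈ Ξ (D.param s)) (hz : z ∈ Ξ (D.param s)) :
    ENNReal.ofReal (|g y - g z| + min |g y| |g z|) ≤
      liminf (fun ε => localVariation D g (v ε) s ρ) (𝓝[>] 0) := by
  obtain ⟨p, hpD, hps, hpy⟩ := h.exists_tendsto_lift hs hy
  obtain ⟨q, hqD, hqs, hqz⟩ := h.exists_tendsto_lift hs hz
  obtain ⟨β, ⟨hβD, hβ⟩, hβs, hβ1⟩ := exists_ne_eq_one hΞ hs hρ
  have hgp := (hg.tendsto y).comp hpy
  have hgq := (hg.tendsto z).comp hqz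
  have hgβ := (hg.tendsto 1).comp (h.tendsto_of_eq_singleton hΞ.1.1 hβ1)
  refine ofReal_le_liminf_of_tendsto
    (by simpa [hg1] using ((hgp.sub hgq).abs.add (hgp.abs.min hgq.abs)).sub hgβ.abs) ?_
  have hside : ∀ᶠ ε in 𝓝[>] (0 : ℝ), p ε ≤ β ∧ q ε ≤ β ∨ β ≤ p ε ∧ β ≤ q ε := by
    rcases hβs.lt_or_gt with hβs | hβs
    · filter_upwards [hps.eventually_const_le hβs, hqs.eventually_const_le hβs] with ε hp hq
      exact Or.inr ⟨hp, hq⟩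
    · filter_upwards [hps.eventually_le_const hβs, hqs.eventually_le_const hβs] with ε hp hq
      exact Or.inl ⟨hp, hq⟩
  filter_upwards [hps (Metric.ball_mem_nhds s hρ), hqs (Metric.ball_mem_nhds s hρ), hside]
    with ε hp hq hside
  exact ofReal_abs_sub_add_min_le_eVariationOn (f := fun t => g (v ε (D.param t)))
    ⟨hpD ε, hp⟩ ⟨hqD ε, hq⟩ ⟨hβD, hβ⟩ hside

lemma ofReal_abs_sub_add_add_le_liminf_localVariation (hg : Continuous g) (hg1 : g 1 = 0)
    (h : GraphTendsto v Ξ) (hΞ : Ξ ∈ classA₀ D.Pt) (hs : s ∈ D.coordSet)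
    (hb : D.param s ∉ D.boundary) (hρ : 0 < ρ) (hy : y ∈ Ξ (D.param s)) (hz : z ∈ Ξ (D.param s)) :
    ENNReal.ofReal (|g y - g z| + (|g y| + |g z|)) ≤
      liminf (fun ε => localVariation D g (v ε) s ρ) (𝓝[>] 0) := by
  obtain ⟨p, hpD, hps, hpy⟩ := h.exists_tendsto_lift hs hy
  obtain ⟨q, hqD, hqs, hqz⟩ := h.exists_tendsto_lift hs hz
  obtain ⟨⟨t, ht, hts⟩, u, hu, hsu⟩ := D.exists_lt_lt_mem_coordSet hs hb
  obtain ⟨α, ⟨hαD, hα⟩, hαs, hα1⟩ := exists_lt_eq_one hΞ hs ht hts hρ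
  obtain ⟨β, ⟨hβD, hβ⟩, hsβ, hβ1⟩ := exists_gt_eq_one hΞ hs hu hsu hρ
  have hgp := (hg.tendsto y).comp hpy
  have hgq := (hg.tendsto z).comp hqz
  have hgα := (hg.tendsto 1).comp (h.tendsto_of_eq_singleton hΞ.1.1 hα1)
  have hgβ := (hg.tendsto 1).comp (h.tendsto_of_eq_singleton hΞ.1.1 hβ1)
  refine ofReal_le_liminf_of_tendsto (by simpa [hg1] using
    ((hgp.sub hgq).abs.add (hgp.abs.add hgq.abs)).sub (hgα.abs.add hgβ.abs)) ?_
  filter_upwards [hps (Metric.ball_mem_nhds s hρ), hqs (Metric.ball_mem_nhds s hρ),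
    hps.eventually_const_le hαs, hqs.eventually_const_le hαs, hps.eventually_le_const hsβ,
    hqs.eventually_le_const hsβ] with ε hp hq hαp hαq hpβ hqβ
  exact ofReal_abs_sub_add_add_le_eVariationOn (f := fun t => g (v ε (D.param t)))
    ⟨hαD, hα⟩ ⟨hpD ε, hp⟩ ⟨hqD ε, hq⟩ ⟨hβD, hβ⟩ hαp hαq hpβ hqβ

end LocalLowerBound

section JumpCost

variable {D : Domain} {Ξ : D.Pt → Set ℝ}

/-- The term of `limitEnergy` at the point `x`. -/
noncomputable def jumpCost (D : Domain) (F : ℝ → ℝ) (Ξ : D.Pt → Set ℝ) (x : D.Pt) : ℝ :=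
  2 * (G F (sInf (Ξ x)) + G F (sSup (Ξ x))) -
    kappa D x * max (G F (sInf (Ξ x))) (G F (sSup (Ξ x)))

lemma jumpCost_of_mem_boundary (F : ℝ → ℝ) (Ξ : D.Pt → Set ℝ) {x : D.Pt} (hx : x ∈ D.boundary) :
    jumpCost D F Ξ x = G F (sInf (Ξ x)) + G F (sSup (Ξ x)) +
      min (G F (sInf (Ξ x))) (G F (sSup (Ξ x))) := by
  rw [jumpCost, kappa, Set.indicator_of_mem hx, Pi.one_apply]
  linarith [max_add_min (G F (sInf (Ξ x))) (G F (sSup (Ξ x)))]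

lemma jumpCost_of_notMem_boundary (F : ℝ → ℝ) (Ξ : D.Pt → Set ℝ) {x : D.Pt}
    (hx : x ∉ D.boundary) : jumpCost D F Ξ x = 2 * (G F (sInf (Ξ x)) + G F (sSup (Ξ x))) := by
  rw [jumpCost, kappa, Set.indicator_of_notMem hx, zero_mul, sub_zero]

lemma eq_singleton_of_notMem_exceptional (hΞ : Ξ ∈ classA₀ D.Pt) {x : D.Pt}
    (hx : x ∉ exceptional Ξ) : Ξ x = {1} :=
  (Set.not_nontrivial_iff.1 hx).eq_singleton_of_mem (one_mem_of_mem_classA₀ hΞ x)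

lemma limitEnergy_eq_tsum (F : ℝ → ℝ) (hΞ : Ξ ∈ classA₀ D.Pt) :
    limitEnergy D F Ξ = ∑' x, ENNReal.ofReal (jumpCost D F Ξ x) := by
  rw [limitEnergy, if_pos hΞ]
  refine tsum_subtype_eq_of_support_subset (f := fun x => ENNReal.ofReal (jumpCost D F Ξ x))
    (Function.support_subset_iff'.2 fun x hx => ?_)
  simp [jumpCost, eq_singleton_of_notMem_exceptional hΞ hx]

end JumpCost

section Liminf

variable {D : Domain} {F : ℝ → ℝ} {Ξ : D.Pt → Set ℝ} {v : ℝ → C(D.Pt, ℝ)}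

lemma exists_ball_subset_preimage_param {s : ℝ} {U : Set D.Pt} (hU : IsOpen U)
    (hs : D.param s ∈ U) :
    ∃ ρ > 0, ρ ≤ 1 / 2 ∧ ∀ t ∈ Metric.ball s ρ, D.param t ∈ U := by
  obtain ⟨r, hr, hrU⟩ := Metric.isOpen_iff.1 (hU.preimage D.continuous_param) s hs
  exact ⟨min r (1 / 2), by positivity, min_le_right _ _,
    fun t ht => hrU (Metric.ball_subset_ball (min_le_left _ _) ht)⟩

lemma liminf_localVariation_le_liminf_localEnergy (hF : Continuous F) (hF0 : ∀ y, 0 ≤ F y)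
    (hv : ∀ᶠ ε in 𝓝[>] 0, MemH1 D (v ε)) {s ρ : ℝ} (hρ : ρ ≤ 1 / 2) {U : Set D.Pt}
    (hUo : IsOpen U) (hU : ∀ t ∈ Metric.ball s ρ, D.param t ∈ U) :
    liminf (fun ε => localVariation D (primG F) (v ε) s ρ) (𝓝[>] 0) ≤
      liminf (fun ε => localEnergy D F ε (v ε) U) (𝓝[>] 0) := by
  refine liminf_le_liminf ?_
  filter_upwards [self_mem_nhdsWithin, hv] with ε hε hv
  exact localVariation_primG_le_localEnergy hF hF0 hε hv hρ hUo hU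

lemma ofReal_abs_primG_sub_le_liminf_localEnergy (hF : Continuous F) (hF0 : ∀ y, 0 ≤ F y)
    (hv : ∀ᶠ ε in 𝓝[>] 0, MemH1 D (v ε)) (h : GraphTendsto v Ξ) {x : D.Pt} {U : Set D.Pt}
    (hU : IsOpen U) (hx : x ∈ U) {y z : ℝ} (hy : y ∈ Ξ x) (hz : z ∈ Ξ x) :
    ENNReal.ofReal |primG F y - primG F z| ≤
      liminf (fun ε => localEnergy D F ε (v ε) U) (𝓝[>] 0) := by
  obtain ⟨s, hs, rfl⟩ := D.exists_coord x
  obtain ⟨ρ, hρ, hρ2, hρU⟩ := exists_ball_subset_preimage_param hU hx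
  exact (ofReal_abs_sub_le_liminf_localVariation (contDiff_primG hF).continuous h hs hρ hy hz).trans
    (liminf_localVariation_le_liminf_localEnergy hF hF0 hv hρ2 hU hρU)

lemma ofReal_jumpCost_le_liminf_localEnergy (hF : Continuous F) (hF0 : ∀ y, 0 ≤ F y)
    (hv : ∀ᶠ ε in 𝓝[>] 0, MemH1 D (v ε)) (h : GraphTendsto v Ξ) (hΞ : Ξ ∈ classA₀ D.Pt)
    {x : D.Pt} {U : Set D.Pt} (hU : IsOpen U) (hx : x ∈ U) :
    ENNReal.ofReal (jumpCost D F Ξ x) ≤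
      liminf (fun ε => localEnergy D F ε (v ε) U) (𝓝[>] 0) := by
  obtain ⟨s, hs, rfl⟩ := D.exists_coord x
  obtain ⟨ρ, hρ, hρ2, hρU⟩ := exists_ball_subset_preimage_param hU hx
  refine le_trans ?_ (liminf_localVariation_le_liminf_localEnergy hF hF0 hv hρ2 hU hρU)
  have hcompact := isCompact_of_mem_classB hΞ.1.1 (D.param s)
  have hne : (Ξ (D.param s)).Nonempty := ⟨1, one_mem_of_mem_classA₀ hΞ _⟩
  have hinf := hcompact.sInf_mem hne
  have hsup := hcompact.sSup_mem hne
  have hsub := abs_primG_sub_primG (F := F) (sInf_le_one hΞ (D.param s))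
    (one_le_sSup hΞ (D.param s))
  have hg := (contDiff_primG hF).continuous
  by_cases hb : D.param s ∈ D.boundary
  · have := ofReal_abs_sub_add_min_le_liminf_localVariation hg (primG_one F) h hΞ hs hρ hinf hsup
    rwa [hsub, abs_primG, abs_primG, ← jumpCost_of_mem_boundary F Ξ hb] at this
  · have := ofReal_abs_sub_add_add_le_liminf_localVariation hg (primG_one F) h hΞ hs hb hρ
      hinf hsup
    rwa [hsub, abs_primG, abs_primG, ← two_mul, ← jumpCost_of_notMem_boundary F Ξ hb] at this

lemma liminf_add_liminf_le {ι : Type*} (l : Filter ι) (f g : ι → ℝ≥0∞) :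
    liminf f l + liminf g l ≤ liminf (fun i => f i + g i) l := by
  rw [liminf_eq_iSup_iInf (u := f), liminf_eq_iSup_iInf (u := g)]
  refine ENNReal.biSup_add_biSup_le' ⟨_, univ_mem⟩ ⟨_, univ_mem⟩ fun s hs t ht => ?_
  refine le_liminf_of_le (by isBoundedDefault) ?_
  filter_upwards [hs, ht] with i his hit
  exact add_le_add (iInf₂_le i his) (iInf₂_le i hit)

lemma sum_liminf_le_liminf_sum {ι α : Type*} {l : Filter ι} (T : Finset α)
    (f : α → ι → ℝ≥0∞) :
    ∑ x ∈ T, liminf (f x) l ≤ liminf (fun i => ∑ x ∈ T, f x i) l := by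
  classical
  induction T using Finset.induction_on with
  | empty => simp
  | insert x T hx ih =>
    simp only [Finset.sum_insert hx]
    exact (add_le_add_right ih _).trans (liminf_add_liminf_le l (f x) _)

lemma tsum_le_liminf_energy (hF : Continuous F) (hF0 : ∀ y, 0 ≤ F y)
    (hv : ∀ᶠ ε in 𝓝[>] 0, MemH1 D (v ε)) {c : D.Pt → ℝ≥0∞}
    (hc : ∀ x U, IsOpen U → x ∈ U → c x ≤ liminf (fun ε => localEnergy D F ε (v ε) U) (𝓝[>] 0)) :
    ∑' x, c x ≤ liminf (fun ε => ENNReal.ofReal (energy D F ε (v ε))) (𝓝[>] 0) := by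
  rw [ENNReal.tsum_eq_iSup_sum]
  refine iSup_le fun T => ?_
  obtain ⟨U, hU, hdisj⟩ := T.finite_toSet.t2_separation
  calc ∑ x ∈ T, c x
      ≤ ∑ x ∈ T, liminf (fun ε => localEnergy D F ε (v ε) (U x)) (𝓝[>] 0) :=
        Finset.sum_le_sum fun x _ => hc x (U x) (hU x).2 (hU x).1
    _ ≤ liminf (fun ε => ∑ x ∈ T, localEnergy D F ε (v ε) (U x)) (𝓝[>] 0) :=
        sum_liminf_le_liminf_sum T _
    _ ≤ liminf (fun ε => ENNReal.ofReal (energy D F ε (v ε))) (𝓝[>] 0) := by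
        refine liminf_le_liminf ?_
        filter_upwards [self_mem_nhdsWithin, hv] with ε hε hv
        exact sum_localEnergy_le_energy hF hF0 hε hv (fun x => (hU x).2) hdisj

lemma CondF1.exists_pos_le (hF : CondF1 F) (R : ℝ) {ρ : ℝ} (hρ : 0 < ρ) :
    ∃ m > 0, ∀ y, |y| ≤ R → ρ ≤ dist y 1 → m ≤ F y := by
  have hcompact : IsCompact (Set.Icc (-R) R ∩ {y | ρ ≤ dist y 1}) :=
    isCompact_Icc.inter_right (isClosed_le continuous_const (by fun_prop))
  obtain ⟨m, hm, hle⟩ := hcompact.exists_forall_le' hF.1.continuousOn (a := 0) fun y hy =>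
    (hF.2.1 y).lt_of_ne' (mt (hF.2.2 y).1 (dist_pos.1 (hρ.trans_le hy.2)))
  exact ⟨m, hm, fun y hyR hyρ => hle y ⟨abs_le.1 hyR, hyρ⟩⟩

lemma ofReal_le_setLIntegral_density {ε m s t : ℝ} (hε : 0 < ε) {u : C(D.Pt, ℝ)}
    (hm : ∀ x ∈ Set.Ioc s t, m ≤ F (u (D.param x))) :
    ENNReal.ofReal (1 / (2 * ε) * m) * ENNReal.ofReal (t - s) ≤
      ∫⁻ x in Set.Ioc s t, density D F ε u x := by
  rw [← Real.volume_Ioc, ← setLIntegral_const]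
  refine setLIntegral_mono' measurableSet_Ioc fun x hx => ENNReal.ofReal_le_ofReal ?_
  have := hm x hx
  exact le_add_of_nonneg_of_le (by positivity) (by gcongr)

lemma exists_Ioc_subset_preimage_param {x : D.Pt} {U : Set D.Pt} (hU : IsOpen U) (hx : x ∈ U) :
    ∃ s ∈ D.coordSet, ∃ t ∈ D.coordSet, s < t ∧ t ≤ s + 1 ∧ ∀ y ∈ Set.Ioc s t, D.param y ∈ U := by
  obtain ⟨s, hs, rfl⟩ := D.exists_coord x
  obtain ⟨ρ, hρ, hρ2, hρU⟩ := exists_ball_subset_preimage_param hU hx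
  obtain ⟨t, ⟨ht, htρ⟩, hts⟩ := D.exists_ne_mem_coordSet hs hρ
  have hsub := (convex_ball s ρ).ordConnected.out
  have hdist := (Metric.mem_ball.1 htρ).le.trans hρ2
  rw [Real.dist_eq, abs_le] at hdist
  rcases hts.lt_or_gt with hts | hst
  · exact ⟨t, ht, s, hs, hts, by linarith,
      fun y hy => hρU y (hsub htρ (Metric.mem_ball_self hρ) (Set.Ioc_subset_Icc_self hy))⟩
  · exact ⟨s, hs, t, ht, hst, by linarith,
      fun y hy => hρU y (hsub (Metric.mem_ball_self hρ) htρ (Set.Ioc_subset_Icc_self hy))⟩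

lemma tendsto_localEnergy_top (hF : CondF1 F) {x : D.Pt} {ρ R : ℝ} (hρ : 0 < ρ)
    (hR : ∀ᶠ ε in 𝓝[>] (0 : ℝ), ∀ p, |v ε p| ≤ R)
    (hfar : ∀ᶠ ε in 𝓝[>] (0 : ℝ), ∀ p ∈ Metric.ball x ρ, ρ ≤ dist (v ε p) 1) :
    Tendsto (fun ε => localEnergy D F ε (v ε) (Metric.ball x ρ)) (𝓝[>] 0) (𝓝 ⊤) := by
  obtain ⟨m, hm, hmF⟩ := hF.exists_pos_le R hρ
  obtain ⟨s, hs, t, ht, hst, hts, hU⟩ :=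
    exists_Ioc_subset_preimage_param Metric.isOpen_ball (Metric.mem_ball_self (x := x) hρ)
  have hbound : ∀ᶠ ε in 𝓝[>] 0, ENNReal.ofReal (1 / (2 * ε) * m) * ENNReal.ofReal (t - s) ≤
      localEnergy D F ε (v ε) (Metric.ball x ρ) := by
    filter_upwards [self_mem_nhdsWithin, hR, hfar] with ε hε hR hfar
    exact (ofReal_le_setLIntegral_density hε fun y hy => hmF _ (hR _) (hfar _ (hU y hy))).trans
      (setLIntegral_density_le_localEnergy D F ε (v ε) hs ht hts Metric.isOpen_ball hU)
  have hcoeff : Tendsto (fun ε : ℝ => 1 / (2 * ε) * m) (𝓝[>] 0) atTop := by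
    refine (tendsto_inv_nhdsGT_zero.const_mul_atTop (half_pos hm)).congr fun ε => ?_
    rw [one_div, mul_inv, div_eq_mul_inv]
    ring
  refine tendsto_nhds_top_mono ?_ hbound
  have := ENNReal.Tendsto.mul_const (ENNReal.tendsto_ofReal_atTop.comp hcoeff)
    (b := ENNReal.ofReal (t - s)) (Or.inl ENNReal.top_ne_zero)
  rwa [ENNReal.top_mul (ENNReal.ofReal_pos.2 (sub_pos.2 hst)).ne'] at this

lemma one_mem_of_liminf_energy_lt_top (hF : CondF1 F) (hv : ∀ᶠ ε in 𝓝[>] 0, MemH1 D (v ε))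
    (h : GraphTendsto v Ξ) (hΞ : Ξ ∈ classB D.Pt)
    (hfin : liminf (fun ε => ENNReal.ofReal (energy D F ε (v ε))) (𝓝[>] 0) < ⊤) (x : D.Pt) :
    1 ∈ Ξ x := by
  refine h.mem_of_frequently hΞ fun ρ hρ => ?_
  by_contra hfar
  obtain ⟨R, hR⟩ := h.exists_eventually_abs_le hΞ
  have hlocal := tendsto_localEnergy_top hF hρ hR (x := x) <|
    (not_frequently.1 hfar).mono fun ε hε p hp => le_of_not_gt fun hd => hε ⟨p, hp, hd⟩
  refine hfin.not_ge (hlocal.liminf_eq.ge.trans (liminf_le_liminf ?_))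
  filter_upwards [self_mem_nhdsWithin, hv] with ε hε hv
  exact localEnergy_le_energy hF.1 hF.2.1 hε hv _

lemma GraphTendsto.ordConnected (h : GraphTendsto v Ξ) (hΞ : Ξ ∈ classB D.Pt) (x : D.Pt) :
    (Ξ x).OrdConnected := by
  obtain ⟨s, hs, rfl⟩ := D.exists_coord x
  refine ⟨fun y hy z hz c hc => ?_⟩
  rcases hc.1.eq_or_lt with rfl | hyc
  · exact hy
  rcases hc.2.eq_or_lt with rfl | hcz
  · exact hz
  obtain ⟨p, -, hps, hpy⟩ := h.exists_tendsto_lift hs hy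
  obtain ⟨q, -, hqs, hqz⟩ := h.exists_tendsto_lift hs hz
  refine h.mem_of_frequently hΞ fun ρ hρ => Eventually.frequently ?_
  filter_upwards [hps (Metric.ball_mem_nhds s hρ), hqs (Metric.ball_mem_nhds s hρ),
    hpy.eventually_le_const hyc, hqz.eventually_const_le hcz] with ε hp hq hpc hcq
  obtain ⟨t, ht, htc⟩ := intermediate_value_uIcc
    ((v ε).continuous.comp D.continuous_param).continuousOn (Set.Icc_subset_uIcc ⟨hpc, hcq⟩)
  have htρ := (convex_ball s ρ).ordConnected.uIcc_subset hp hq ht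
  exact ⟨D.param t, (D.dist_param_le t s).trans_lt htρ, by simpa [← htc] using hρ⟩

lemma mem_classA₀_of_liminf_energy_lt_top (hF : CondF1 F)
    (hv : ∀ᶠ ε in 𝓝[>] 0, MemH1 D (v ε)) (h : GraphTendsto v Ξ) (hΞ : Ξ ∈ classB D.Pt)
    (hfin : liminf (fun ε => ENNReal.ofReal (energy D F ε (v ε))) (𝓝[>] 0) < ⊤) :
    Ξ ∈ classA₀ D.Pt := by
  have hone := one_mem_of_liminf_energy_lt_top hF hv h hΞ hfin
  have hcompact := isCompact_of_mem_classB hΞ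
  have hIcc (x : D.Pt) : Ξ x = Set.Icc (sInf (Ξ x)) (sSup (Ξ x)) :=
    eq_Icc_of_connected_compact
      ⟨⟨1, hone x⟩, (h.ordConnected hΞ x).isPreconnected⟩ (hcompact x)
  refine ⟨⟨hΞ, fun x => ⟨sInf (Ξ x), sSup (Ξ x), Real.sInf_le_sSup _ (hcompact x).bddBelow
    (hcompact x).bddAbove, hIcc x⟩⟩, ?_⟩
  have hsum := tsum_le_liminf_energy hF.1 hF.2.1 hv
    (c := fun x => ENNReal.ofReal |primG F (sInf (Ξ x)) - primG F (sSup (Ξ x))|)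
    fun x U hU hx => ofReal_abs_primG_sub_le_liminf_localEnergy hF.1 hF.2.1 hv h hU hx
      ((hcompact x).sInf_mem ⟨1, hone x⟩) ((hcompact x).sSup_mem ⟨1, hone x⟩)
  refine (Summable.countable_support_ennreal (hsum.trans_lt hfin).ne).mono ?_
  refine fun x hx hzero => hx ?_
  rw [ENNReal.ofReal_eq_zero, abs_nonpos_iff, sub_eq_zero,
    (strictMono_primG hF).injective.eq_iff] at hzero
  have hsub : (Ξ x).Subsingleton := hIcc x ▸ Set.subsingleton_Icc_of_ge hzero.ge
  exact hsub.eq_singleton_of_mem (hone x)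

lemma limitEnergy_le_liminf (hF : CondF1 F) (hv : ∀ᶠ ε in 𝓝[>] 0, MemH1 D (v ε))
    (h : GraphTendsto v Ξ) (hΞ : Ξ ∈ classB D.Pt) :
    limitEnergy D F Ξ ≤ liminf (fun ε => ENNReal.ofReal (energy D F ε (v ε))) (𝓝[>] 0) := by
  rcases eq_top_or_lt_top (liminf (fun ε => ENNReal.ofReal (energy D F ε (v ε))) (𝓝[>] 0))
    with htop | hfin
  · exact htop ▸ le_top
  have hΞ₀ := mem_classA₀_of_liminf_energy_lt_top hF hv h hΞ hfin
  rw [limitEnergy_eq_tsum F hΞ₀]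
  exact tsum_le_liminf_energy hF.1 hF.2.1 hv fun x U hU hx =>
    ofReal_jumpCost_le_liminf_localEnergy hF.1 hF.2.1 hv h hΞ₀ hU hx

lemma ofReal_mul_sInf_sq_le_liminf {b : ℝ} (hb : 0 ≤ b) (h : GraphTendsto v Ξ)
    (hΞ : Ξ ∈ classB D.Pt) {a : D.Pt} (ha : b = 0 ∨ 0 ≤ sInf (Ξ a)) :
    ENNReal.ofReal (b * sInf (Ξ a) ^ 2) ≤
      liminf (fun ε => ENNReal.ofReal (b * v ε a ^ 2)) (𝓝[>] 0) := by
  rcases ha with rfl | ha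
  · simp
  have hlim : Tendsto (fun k : ℝ => ENNReal.ofReal (b * max k 0 ^ 2)) (𝓝[<] sInf (Ξ a))
      (𝓝 (ENNReal.ofReal (b * max (sInf (Ξ a)) 0 ^ 2))) :=
    ((ENNReal.continuous_ofReal.comp (by fun_prop)).tendsto _).mono_left nhdsWithin_le_nhds
  rw [max_eq_left ha] at hlim
  refine le_of_tendsto hlim ?_
  filter_upwards [self_mem_nhdsWithin] with k hk
  refine le_liminf_of_le (by isBoundedDefault) ?_
  filter_upwards [h.eventually_mem hΞ isOpen_Ioi fun y hy => lt_of_lt_of_le hk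
    (csInf_le (isCompact_of_mem_classB hΞ a).bddBelow hy)] with ε hε
  have hle : max k 0 ≤ |v ε a| := max_le (hε.le.trans (le_abs_self _)) (abs_nonneg _)
  rw [← sq_abs (v ε a)]
  gcongr

lemma limitEnergyB_le_liminf (hF : CondF1 F) {b : ℝ} (hb : 0 ≤ b)
    (hv : ∀ᶠ ε in 𝓝[>] 0, MemH1 D (v ε)) (h : GraphTendsto v Ξ) (hΞ : Ξ ∈ classB D.Pt)
    {a : D.Pt} (ha : b = 0 ∨ 0 ≤ sInf (Ξ a)) :
    limitEnergyB D F a b Ξ ≤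
      liminf (fun ε => ENNReal.ofReal (energyB D F a b ε (v ε))) (𝓝[>] 0) := by
  refine (add_le_add (limitEnergy_le_liminf hF hv h hΞ)
    (ofReal_mul_sInf_sq_le_liminf hb h hΞ ha)).trans
      ((liminf_add_liminf_le _ _ _).trans (liminf_le_liminf ?_))
  filter_upwards [self_mem_nhdsWithin] with ε hε
  exact (ofReal_energyB hF.2.1 hε hb a (v ε)).ge

end Liminf

section Profile

lemma surjective_of_hasDerivAt_of_le {T T' : ℝ → ℝ} {k : ℝ} (hk : 0 < k)
    (hT : ∀ y, HasDerivAt T (T' y) y) (hle : ∀ y, k ≤ T' y) : Function.Surjective T := by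
  have hd (y : ℝ) : HasDerivAt (fun y => T y - k * y) (T' y - k) y := by
    simpa using (hT y).fun_sub ((hasDerivAt_id y).const_mul k)
  have hmono : Monotone fun y => T y - k * y :=
    monotone_of_deriv_nonneg (fun y => (hd y).differentiableAt) fun y => by
      rw [(hd y).deriv, sub_nonneg]
      exact hle y
  have htop : Tendsto T atTop atTop := by
    refine tendsto_atTop_mono' atTop (f₁ := fun y => k * y + (T 0 - k * 0)) ?_
      (tendsto_atTop_add_const_right _ _ (tendsto_id.const_mul_atTop hk))
    filter_upwards [eventually_ge_atTop 0] with y hy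
    have : T 0 - k * 0 ≤ T y - k * y := hmono hy
    linarith
  have hbot : Tendsto T atBot atBot := by
    refine tendsto_atBot_mono' atBot (f₁ := fun y => k * y + (T 0 - k * 0)) ?_
      (tendsto_atBot_add_const_right _ _ (tendsto_id.const_mul_atBot hk))
    filter_upwards [eventually_le_atBot 0] with y hy
    have : T y - k * y ≤ T 0 - k * 0 := hmono hy
    linarith
  exact (continuous_iff_continuousAt.2 fun y => (hT y).continuousAt).surjective htop hbot

/-- `q` is a global solution of the equation `q' = √(H q)`, `q 0 = 1`, of optimal transition
profiles for the potential `H`, running through all values. -/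
structure IsProfile (H : ℝ → ℝ) (q : C(ℝ, ℝ)) : Prop where
  zero : q 0 = 1
  hasDerivAt : ∀ t, HasDerivAt q (√(H (q t))) t
  surjective : Function.Surjective q

variable {F H : ℝ → ℝ} {q : C(ℝ, ℝ)}

lemma IsProfile.monotone (hq : IsProfile H q) : Monotone q :=
  monotone_of_deriv_nonneg (fun t => (hq.hasDerivAt t).differentiableAt) fun t => by
    rw [(hq.hasDerivAt t).deriv]
    exact Real.sqrt_nonneg _

lemma IsProfile.lipschitzWith (hq : IsProfile H q) {C : ℝ} (hC : ∀ y, H y ≤ C) :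
    LipschitzWith (Real.toNNReal √C) q := by
  refine lipschitzWith_of_nnnorm_deriv_le (fun t => (hq.hasDerivAt t).differentiableAt)
    fun t => ?_
  rw [(hq.hasDerivAt t).deriv, ← NNReal.coe_le_coe, coe_nnnorm, Real.norm_eq_abs,
    abs_of_nonneg (Real.sqrt_nonneg _), Real.coe_toNNReal _ (Real.sqrt_nonneg _)]
  exact Real.sqrt_le_sqrt (hC _)

-- The profile is the inverse of `y ↦ ∫₁ʸ 1 / √H`, the time at which the value `y` is reached.
lemma exists_isProfile (hH : Continuous H) (hpos : ∀ y, 0 < H y) {C : ℝ} (hC : ∀ y, H y ≤ C) :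
    ∃ q, IsProfile H q := by
  have hs (y : ℝ) : 0 < √(H y) := Real.sqrt_pos.2 (hpos y)
  have hc : Continuous fun y => (√(H y))⁻¹ := hH.sqrt.inv₀ fun y => (hs y).ne'
  set T : ℝ → ℝ := fun y => ∫ τ in (1 : ℝ)..y, (√(H τ))⁻¹
  have hT (y : ℝ) : HasDerivAt T (√(H y))⁻¹ y := (hc.integral_hasStrictDerivAt 1 y).hasDerivAt
  have hmono : StrictMono T := strictMono_of_deriv_pos fun y => by
    rw [(hT y).deriv]
    exact inv_pos.2 (hs y)
  have hsurj : Function.Surjective T :=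
    surjective_of_hasDerivAt_of_le
      (inv_pos.2 (Real.sqrt_pos.2 ((hpos 0).trans_le (hC 0)))) hT
      fun y => inv_anti₀ (hs y) (Real.sqrt_le_sqrt (hC y))
  set e : ℝ ≃o ℝ := hmono.orderIsoOfSurjective T hsurj
  have he (y : ℝ) : e y = T y := rfl
  refine ⟨⟨e.symm, e.symm.continuous⟩, ?_, fun t => ?_, e.symm.surjective⟩
  · change e.symm 0 = 1
    exact (OrderIso.symm_apply_eq e).2 intervalIntegral.integral_same.symm
  · have hinv := HasDerivAt.of_local_left_inverse (f := T) (g := e.symm) (a := t)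
      e.symm.continuous.continuousAt (hT (e.symm t)) (inv_pos.2 (hs _)).ne'
      (Eventually.of_forall fun y => by rw [← he, OrderIso.apply_symm_apply])
    rwa [inv_inv] at hinv

lemma G_le_of_perturb (hF : Continuous F) (hF0 : ∀ y, 0 ≤ F y) (hH : Continuous H)
    {δ ξ : ℝ} (hδ : 0 ≤ δ) (h : ∀ y ∈ Set.uIcc 1 ξ, H y = F y + δ) :
    G H ξ ≤ G F ξ + √δ * |ξ - 1| := by
  have hdiff : primG H ξ - primG F ξ = ∫ τ in (1 : ℝ)..ξ, (√(H τ) - √(F τ)) :=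
    (intervalIntegral.integral_sub (hH.sqrt.intervalIntegrable _ _)
      (hF.sqrt.intervalIntegrable _ _)).symm
  have hbound : |primG H ξ - primG F ξ| ≤ √δ * |ξ - 1| := by
    rw [hdiff, ← Real.norm_eq_abs]
    refine intervalIntegral.norm_integral_le_of_norm_le_const fun y hy => ?_
    rw [h y (Set.uIoc_subset_uIcc hy), Real.norm_eq_abs, abs_of_nonneg
      (sub_nonneg.2 (Real.sqrt_le_sqrt (by linarith))), sub_le_iff_le_add']
    refine Real.sqrt_le_iff.2 ⟨by positivity, ?_⟩
    rw [add_sq, Real.sq_sqrt (hF0 y), Real.sq_sqrt hδ]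
    linarith [mul_nonneg (Real.sqrt_nonneg (F y)) (Real.sqrt_nonneg δ)]
  have := abs_sub_abs_le_abs_sub (primG H ξ) (primG F ξ)
  rw [abs_primG, abs_primG] at this
  linarith

-- A transition at the speed `√F` would reach the zero `1` of `F` only in infinite time, so a
-- small constant is added to `F` on `[-R, R]`.
lemma exists_isProfile_above (hF : Continuous F) (hF0 : ∀ y, 0 ≤ F y) {R : ℝ} (hR : 1 ≤ R)
    {η : ℝ} (hη : 0 < η) :
    ∃ (H : ℝ → ℝ) (q : C(ℝ, ℝ)) (K : NNReal), Continuous H ∧ (∀ y, 0 ≤ H y) ∧ IsProfile H q ∧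
      LipschitzWith K q ∧
      ∀ ξ, |ξ| ≤ R → (∀ y ∈ Set.uIcc 1 ξ, F y ≤ H y) ∧ G H ξ ≤ G F ξ + η := by
  have hRR : -R ≤ R := by linarith
  set δ := (η / (R + 1)) ^ 2 with hδ
  have hδ0 : 0 < δ := by positivity
  set H : ℝ → ℝ := fun y => F (Set.projIcc (-R) R hRR y) + δ
  have hH : Continuous H :=
    (hF.comp (continuous_subtype_val.comp continuous_projIcc)).add continuous_const
  have hpos (y : ℝ) : 0 < H y := add_pos_of_nonneg_of_pos (hF0 _) hδ0
  obtain ⟨C, hC⟩ := (isCompact_Icc (a := -R) (b := R)).exists_bound_of_continuousOn hF.continuousOn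
  have hHC (y : ℝ) : H y ≤ C + δ :=
    add_le_add_left ((le_abs_self _).trans (hC _ (Set.projIcc (-R) R hRR y).2)) δ
  obtain ⟨q, hq⟩ := exists_isProfile hH hpos hHC
  refine ⟨H, q, _, hH, fun y => (hpos y).le, hq, hq.lipschitzWith hHC, fun ξ hξ => ?_⟩
  have hHF : ∀ y ∈ Set.uIcc 1 ξ, H y = F y + δ := fun y hy => by
    have hyR : y ∈ Set.Icc (-R) R :=
      Set.ordConnected_Icc.uIcc_subset ⟨by linarith, hR⟩ (abs_le.1 hξ) hy
    simp only [H, Set.projIcc_of_mem hRR hyR]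
  refine ⟨fun y hy => by linarith [hHF y hy], ?_⟩
  calc G H ξ ≤ G F ξ + √δ * |ξ - 1| := G_le_of_perturb hF hF0 hH hδ0.le hHF
    _ ≤ G F ξ + η / (R + 1) * (R + 1) := by
        rw [hδ, Real.sqrt_sq (by positivity)]
        gcongr
        exact (abs_sub _ _).trans (by rw [abs_one]; linarith)
    _ = G F ξ + η := by rw [div_mul_cancel₀ _ (by positivity)]

end Profile

section Bump

variable {D : Domain} {F H : ℝ → ℝ} {q : C(ℝ, ℝ)} {K : NNReal} {τ ε d : ℝ}

/-- One side of a bump of height `q τ`, at distance `d` from its centre: the profile `q`, slowed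
down by the factor `ε`, followed from time `τ` back to time `0`. For `τ = 0` the quotient is a
division by zero, and the bump is the constant `q 0`. -/
noncomputable def bumpAt (q : C(ℝ, ℝ)) (τ ε d : ℝ) : ℝ := q (τ * max (1 - d / (ε * |τ|)) 0)

lemma bumpAt_zero (q : C(ℝ, ℝ)) (τ ε : ℝ) : bumpAt q τ ε 0 = q τ := by simp [bumpAt]

lemma bumpAt_of_le (hq : IsProfile H q) (hε : 0 < ε) (hd : ε * |τ| ≤ d) :
    bumpAt q τ ε d = 1 := by
  rcases eq_or_ne τ 0 with rfl | hτ
  · simp [bumpAt, hq.zero]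
  · have : 1 ≤ d / (ε * |τ|) := (one_le_div (by positivity)).2 hd
    rw [bumpAt, max_eq_right (by linarith), mul_zero, hq.zero]

lemma bumpAt_mem_uIcc (hq : IsProfile H q) (hε : 0 < ε) (hd : 0 ≤ d) :
    bumpAt q τ ε d ∈ Set.uIcc 1 (q τ) := by
  set θ := max (1 - d / (ε * |τ|)) 0
  have hθ1 : θ ≤ 1 := max_le (sub_le_self _ (by positivity)) zero_le_one
  have hmem : τ * θ ∈ Set.uIcc 0 τ := by
    rw [← segment_eq_uIcc, segment_eq_image]
    exact ⟨θ, ⟨le_max_right _ _, hθ1⟩, by simp [mul_comm]⟩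
  have := hq.monotone.mapsTo_uIcc hmem
  rwa [hq.zero] at this

lemma continuous_bumpAt (q : C(ℝ, ℝ)) (τ ε : ℝ) : Continuous (bumpAt q τ ε) := by
  unfold bumpAt
  fun_prop

lemma exists_bumpAt_eq (hq : IsProfile H q) (hε : 0 < ε) {z : ℝ} (hz : z ∈ Set.uIcc 1 (q τ)) :
    ∃ d ∈ Set.Icc 0 (ε * |τ|), bumpAt q τ ε d = z := by
  have := intermediate_value_uIcc (a := 0) (b := ε * |τ|) (continuous_bumpAt q τ ε).continuousOn
  rw [bumpAt_zero, bumpAt_of_le hq hε le_rfl, Set.uIcc_comm,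
    Set.uIcc_of_le (by positivity : 0 ≤ ε * |τ|)] at this
  exact this hz

lemma exists_lipschitzWith_bumpAt (hq : LipschitzWith K q) (τ ε : ℝ) :
    ∃ K', LipschitzWith K' (bumpAt q τ ε) := by
  refine ⟨_, hq.comp (Kg := ‖τ / (ε * |τ|)‖₊) (LipschitzWith.of_dist_le_mul fun d d' => ?_)⟩
  rw [coe_nnnorm, Real.norm_eq_abs, Real.dist_eq, Real.dist_eq, ← mul_sub, abs_mul]
  calc |τ| * |max (1 - d / (ε * |τ|)) 0 - max (1 - d' / (ε * |τ|)) 0|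
      ≤ |τ| * |1 - d / (ε * |τ|) - (1 - d' / (ε * |τ|))| :=
        mul_le_mul_of_nonneg_left (abs_max_sub_max_le_abs _ _ _) (abs_nonneg _)
    _ = |τ / (ε * |τ|)| * |d - d'| := by
        rw [← abs_mul, ← abs_mul, ← abs_neg]
        ring_nf

lemma hasDerivAt_bumpAt_of_lt (hq : IsProfile H q) (hd : d < ε * |τ|) (hε : 0 < ε) :
    HasDerivAt (bumpAt q τ ε) (√(H (bumpAt q τ ε d)) * -(τ / (ε * |τ|))) d := by
  have hloc : bumpAt q τ ε =ᶠ[𝓝 d] fun d => q (τ * (1 - d / (ε * |τ|))) := by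
    filter_upwards [eventually_lt_nhds hd] with y hy
    have : y / (ε * |τ|) ≤ 1 := div_le_one_of_le₀ hy.le (by positivity)
    rw [bumpAt, max_eq_left (by linarith)]
  have harg : HasDerivAt (fun d => τ * (1 - d / (ε * |τ|))) (-(τ / (ε * |τ|))) d := by
    refine (((hasDerivAt_id d).div_const (ε * |τ|)).const_sub 1 |>.const_mul τ).congr_deriv ?_
    ring
  rw [hloc.eq_of_nhds]
  exact ((hq.hasDerivAt _).comp d harg).congr_of_eventuallyEq hloc

lemma hasDerivAt_bumpAt_of_gt (hq : IsProfile H q) (hε : 0 < ε) (hd : ε * |τ| < d) :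
    HasDerivAt (bumpAt q τ ε) 0 d := by
  refine (hasDerivAt_const d (1 : ℝ)).congr_of_eventuallyEq ?_
  filter_upwards [eventually_gt_nhds hd] with y hy
  exact bumpAt_of_le hq hε hy.le

/-- The energy density of one side of a bump, for the potential `H` of its profile. -/
noncomputable def bumpDensity (H : ℝ → ℝ) (q : C(ℝ, ℝ)) (τ ε : ℝ) : ℝ → ℝ≥0∞ :=
  (Set.Ioo 0 (ε * |τ|)).indicator fun d => ENNReal.ofReal (H (bumpAt q τ ε d) / ε)

lemma measurable_bumpDensity (hH : Continuous H) : Measurable (bumpDensity H q τ ε) :=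
  Measurable.indicator
    ((hH.comp (continuous_bumpAt q τ ε)).div_const ε).measurable.ennreal_ofReal measurableSet_Ioo

-- Along a bump `√H` times the slope is, up to sign, the derivative of the primitive of `√H`.
lemma lintegral_bumpDensity_le (hq : IsProfile H q) (hH : Continuous H) (hH0 : ∀ y, 0 ≤ H y)
    (hε : 0 < ε) : ∫⁻ d, bumpDensity H q τ ε d ≤ ENNReal.ofReal (G H (q τ)) := by
  rcases eq_or_ne τ 0 with rfl | hτ
  · simp [bumpDensity]
  have hc : Continuous fun d => H (bumpAt q τ ε d) := hH.comp (continuous_bumpAt q τ ε)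
  have h0 : 0 ≤ ε * |τ| := by positivity
  set k := -(τ / (ε * |τ|))
  have hk : |k| = ε⁻¹ := by
    rw [abs_neg, abs_div, abs_mul, abs_abs, abs_of_pos hε]
    field_simp
  have hFTC : ∫ d in (0 : ℝ)..ε * |τ|, H (bumpAt q τ ε d) * k = -primG H (q τ) := by
    rw [intervalIntegral.integral_eq_sub_of_hasDerivAt_of_le h0
      ((contDiff_primG hH).continuous.comp (continuous_bumpAt q τ ε)).continuousOn
      (fun d hd => ?_) ((hc.mul_const k).intervalIntegrable _ _)]
    · simp [bumpAt_zero, bumpAt_of_le hq hε le_rfl]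
    · have := (hasDerivAt_primG hH _).comp d (hasDerivAt_bumpAt_of_lt hq hd.2 hε)
      rwa [← mul_assoc, Real.mul_self_sqrt (hH0 _)] at this
  rw [bumpDensity, lintegral_indicator measurableSet_Ioo, ← ofReal_integral_eq_lintegral_ofReal
    (((hc.div_const ε).integrableOn_Icc (a := 0) (b := ε * |τ|)).mono_set Set.Ioo_subset_Icc_self)
    (ae_of_all _ fun d => div_nonneg (hH0 _) hε.le)]
  apply ENNReal.ofReal_le_ofReal
  rw [← integral_Ioc_eq_integral_Ioo, ← intervalIntegral.integral_of_le h0]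
  calc ∫ d in (0 : ℝ)..ε * |τ|, H (bumpAt q τ ε d) / ε
      = (∫ d in (0 : ℝ)..ε * |τ|, H (bumpAt q τ ε d)) * |k| := by
        rw [intervalIntegral.integral_div, hk, div_eq_mul_inv]
    _ ≤ |∫ d in (0 : ℝ)..ε * |τ|, H (bumpAt q τ ε d) * k| := by
        rw [intervalIntegral.integral_mul_const, abs_mul]
        gcongr
        exact le_abs_self _
    _ = G H (q τ) := by rw [hFTC, abs_neg, abs_primG]

lemma exists_hasDerivAt_bumpAt (hF1 : F 1 = 0) (hq : IsProfile H q) (hH0 : ∀ y, 0 ≤ H y)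
    (hε : 0 < ε) (hFH : ∀ y ∈ Set.uIcc 1 (q τ), F y ≤ H y) (hd0 : 0 < d) (hd : d ≠ ε * |τ|) :
    ∃ β, HasDerivAt (bumpAt q τ ε) β d ∧
      ENNReal.ofReal (ε / 2 * |β| ^ 2 + 1 / (2 * ε) * F (bumpAt q τ ε d)) ≤
        bumpDensity H q τ ε d := by
  rcases hd.lt_or_gt with hlt | hgt
  · refine ⟨_, hasDerivAt_bumpAt_of_lt hq hlt hε, ?_⟩
    rw [bumpDensity, Set.indicator_of_mem (Set.mem_Ioo.2 ⟨hd0, hlt⟩)]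
    apply ENNReal.ofReal_le_ofReal
    have hτ : τ ≠ 0 := by
      rintro rfl
      simp only [abs_zero, mul_zero] at hlt
      exact hlt.not_gt hd0
    have hFle := hFH _ (bumpAt_mem_uIcc (d := d) hq hε hd0.le)
    have hh := hH0 (bumpAt q τ ε d)
    generalize H (bumpAt q τ ε d) = h at hFle hh ⊢
    have hsq : |√h * -(τ / (ε * |τ|))| ^ 2 = h / ε ^ 2 := by
      rw [sq_abs, mul_pow, Real.sq_sqrt hh, neg_sq, div_pow, mul_pow, sq_abs]
      field_simp
    calc ε / 2 * |√h * -(τ / (ε * |τ|))| ^ 2 + 1 / (2 * ε) * F (bumpAt q τ ε d)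
        ≤ ε / 2 * (h / ε ^ 2) + 1 / (2 * ε) * h := by rw [hsq]; gcongr
      _ = h / ε := by field_simp; ring
  · exact ⟨0, hasDerivAt_bumpAt_of_gt hq hε hgt, by simp [bumpAt_of_le hq hε hgt.le, hF1]⟩

end Bump

section MultiBump

variable {D : Domain} {F H : ℝ → ℝ} {q : C(ℝ, ℝ)} {K : NNReal} {ε : ℝ}

lemma setLIntegral_comp_abs_sub_le_two_mul {g : ℝ → ℝ≥0∞} (hg : Measurable g) (s : ℝ)
    (A : Set ℝ) : ∫⁻ x in A, g |x - s| ≤ 2 * ∫⁻ x, g x := by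
  have hpt (x : ℝ) : g |x - s| ≤ g (x - s) + g (s - x) := by
    rcases le_total x s with h | h
    · rw [abs_of_nonpos (sub_nonpos.2 h), neg_sub]
      exact le_add_self
    · rw [abs_of_nonneg (sub_nonneg.2 h)]
      exact le_self_add
  calc ∫⁻ x in A, g |x - s| ≤ ∫⁻ x, g |x - s| := setLIntegral_le_lintegral _ _
    _ ≤ ∫⁻ x, (g (x - s) + g (s - x)) := lintegral_mono hpt
    _ = (∫⁻ x, g (x - s)) + ∫⁻ x, g (s - x) :=
        lintegral_add_left (hg.comp (measurable_id.sub_const s)) _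
    _ = 2 * ∫⁻ x, g x := by
        rw [lintegral_sub_right_eq_self, lintegral_sub_left_eq_self, two_mul]

lemma setLIntegral_Ioc_comp_abs_sub_le (g : ℝ → ℝ≥0∞) {A B s : ℝ} (hs : s ≤ A ∨ B ≤ s) :
    ∫⁻ x in Set.Ioc A B, g |x - s| ≤ ∫⁻ x, g x := by
  rcases hs with h | h
  · calc ∫⁻ x in Set.Ioc A B, g |x - s| = ∫⁻ x in Set.Ioc A B, g (x - s) :=
          setLIntegral_congr_fun measurableSet_Ioc fun x hx => by
            rw [abs_of_pos (by linarith [hx.1])]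
      _ ≤ ∫⁻ x, g (x - s) := setLIntegral_le_lintegral _ _
      _ = ∫⁻ x, g x := lintegral_sub_right_eq_self _ _
  · calc ∫⁻ x in Set.Ioc A B, g |x - s| = ∫⁻ x in Set.Ioc A B, g (s - x) :=
          setLIntegral_congr_fun measurableSet_Ioc fun x hx => by
            rw [abs_of_nonpos (by linarith [hx.2]), neg_sub]
      _ ≤ ∫⁻ x, g (s - x) := setLIntegral_le_lintegral _ _
      _ = ∫⁻ x, g x := lintegral_sub_left_eq_self _ _

-- A parameter interval covering `M` once, on which the distance to `c` is that of parameters: on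
-- the circle, the one centred at `c`.
lemma Domain.exists_chart (D : Domain) (c : D.Pt) : ∃ A B s : ℝ,
    (∀ x ∈ Set.Icc A B, dist (D.param x) c = |x - s|) ∧ (c ∈ D.boundary → s ≤ A ∨ B ≤ s) ∧
    ∀ F ε v, ∫⁻ x in Set.Ioc D.left D.right, density D F ε v x =
      ∫⁻ x in Set.Ioc A B, density D F ε v x := by
  cases D with
  | interval l r h =>
    refine ⟨l, r, (c : Set.Icc l r).1, fun x hx => ?_, fun hc => ?_, fun F ε v => rfl⟩
    · change |(Set.projIcc l r h.le x : ℝ) - (c : Set.Icc l r).1| = _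
      rw [Set.projIcc_of_mem h.le hx]
    · have hc : (c : Set.Icc l r).1 = l ∨ (c : Set.Icc l r).1 = r := hc
      exact hc.imp le_of_eq ge_of_eq
  | circle =>
    obtain ⟨s, rfl⟩ := QuotientAddGroup.mk_surjective (c : UnitAddCircle)
    refine ⟨s - 1 / 2, s - 1 / 2 + 1, s, fun x hx => ?_, fun hc => absurd hc (Set.notMem_empty _),
      fun F ε v => ?_⟩
    · change dist (x : UnitAddCircle) (s : UnitAddCircle) = _
      rw [dist_eq_norm, ← AddCircle.coe_sub, AddCircle.norm_coe_eq_abs_iff _ one_ne_zero, abs_one,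
        abs_le]
      constructor <;> linarith [hx.1, hx.2]
    · simpa [Domain.left, Domain.right] using
        setLIntegral_Ioc_add_one_eq (periodic_density_circle F ε v) 0 (s - 1 / 2)

/-- The function on `M` with a single bump of height `q τ` and width of order `ε` at `c`. -/
noncomputable def bump (q : C(ℝ, ℝ)) (ε τ : ℝ) (c : D.Pt) : C(D.Pt, ℝ) where
  toFun y := bumpAt q τ ε (dist y c)
  continuous_toFun := (continuous_bumpAt q τ ε).comp (continuous_id.dist continuous_const)

lemma bump_apply (q : C(ℝ, ℝ)) (ε τ : ℝ) (c y : D.Pt) :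
    bump q ε τ c y = bumpAt q τ ε (dist y c) := rfl

lemma density_bump_le (hF1 : F 1 = 0) (hq : IsProfile H q) (hH0 : ∀ y, 0 ≤ H y) (hε : 0 < ε)
    {τ : ℝ} (hFH : ∀ y ∈ Set.uIcc 1 (q τ), F y ≤ H y) {c : D.Pt} {s x : ℝ}
    (hdist : ∀ᶠ y in 𝓝 x, dist (D.param y) c = |y - s|) (hxs : x ≠ s) (hxτ : |x - s| ≠ ε * |τ|) :
    density D F ε (bump q ε τ c) x ≤ bumpDensity H q τ ε |x - s| := by
  obtain ⟨β, hβ, hle⟩ :=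
    exists_hasDerivAt_bumpAt hF1 hq hH0 hε hFH (abs_pos.2 (sub_ne_zero.2 hxs)) hxτ
  have hloc : (fun y => bump q ε τ c (D.param y)) =ᶠ[𝓝 x] fun y => bumpAt q τ ε |y - s| :=
    hdist.mono fun y hy => by simp only [bump_apply, hy]
  obtain ⟨σ, hσ, hσ1⟩ : ∃ σ : ℝ, HasDerivAt (fun y => |y - s|) σ x ∧ |σ| = 1 := by
    rcases lt_or_gt_of_ne (sub_ne_zero.2 hxs) with h | h
    · exact ⟨-1, by simpa [Function.comp_def] using
        (hasDerivAt_abs_neg h).comp x ((hasDerivAt_id x).sub_const s), by simp⟩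
    · exact ⟨1, by simpa [Function.comp_def] using
        (hasDerivAt_abs_pos h).comp x ((hasDerivAt_id x).sub_const s), by simp⟩
  have hderiv : deriv (fun y => bump q ε τ c (D.param y)) x = β * σ :=
    ((hβ.comp x hσ).congr_of_eventuallyEq hloc).deriv
  rwa [density, hderiv, hloc.eq_of_nhds, abs_mul, hσ1, mul_one]

lemma lintegral_density_bump_le (hF1 : F 1 = 0) (hq : IsProfile H q) (hH : Continuous H)
    (hH0 : ∀ y, 0 ≤ H y) (hε : 0 < ε) {τ : ℝ} (hFH : ∀ y ∈ Set.uIcc 1 (q τ), F y ≤ H y)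
    (c : D.Pt) :
    ∫⁻ x in Set.Ioc D.left D.right, density D F ε (bump q ε τ c) x ≤
      ENNReal.ofReal ((2 - kappa D c) * G H (q τ)) := by
  obtain ⟨A, B, s, hdist, hbd, hint⟩ := D.exists_chart c
  have hle : ∀ᵐ x ∂volume.restrict (Set.Ioc A B),
      density D F ε (bump q ε τ c) x ≤ bumpDensity H q τ ε |x - s| := by
    have hfin : ({s, s + ε * |τ|, s - ε * |τ|, B} : Set ℝ).Finite := by simp
    filter_upwards [ae_restrict_of_ae (measure_eq_zero_iff_ae_notMem.1 (hfin.measure_zero volume)),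
      ae_restrict_mem measurableSet_Ioc] with x hx hxI
    simp only [Set.mem_insert_iff, Set.mem_singleton_iff, not_or] at hx
    refine density_bump_le hF1 hq hH0 hε hFH ?_ hx.1 fun habs => ?_
    · filter_upwards [Ioo_mem_nhds hxI.1 (hxI.2.lt_of_ne hx.2.2.2)] with y hy
      exact hdist y (Set.Ioo_subset_Icc_self hy)
    · rcases eq_or_eq_neg_of_abs_eq habs with h | h
      · exact hx.2.1 (by linarith)
      · exact hx.2.2.1 (by linarith)
  have hG := lintegral_bumpDensity_le (τ := τ) hq hH hH0 hε
  rw [hint]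
  refine (lintegral_mono_ae hle).trans ?_
  by_cases hc : c ∈ D.boundary
  · refine (setLIntegral_Ioc_comp_abs_sub_le _ (hbd hc)).trans (hG.trans_eq ?_)
    rw [kappa, Set.indicator_of_mem hc, Pi.one_apply]
    norm_num
  · refine (setLIntegral_comp_abs_sub_le_two_mul (measurable_bumpDensity hH) s _).trans ?_
    rw [kappa, Set.indicator_of_notMem hc, sub_zero, ENNReal.ofReal_mul zero_le_two,
      ENNReal.ofReal_ofNat]
    gcongr

lemma memH1_of_lipschitzWith {v : C(D.Pt, ℝ)} (hv : LipschitzWith K v) : MemH1 D v := by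
  have hl : LipschitzWith K fun x => v (D.param x) := by
    simpa using! hv.comp D.lipschitzWith_param
  refine ⟨(hl.lipschitzOnWith (s := Set.uIcc D.left D.right)).absolutelyContinuousOnInterval, ?_⟩
  exact MemLp.of_bound (measurable_deriv _).aestronglyMeasurable K
    (ae_of_all _ fun x => norm_deriv_le_of_lipschitz hl)

lemma measurable_density (hF : Continuous F) (ε : ℝ) (v : C(D.Pt, ℝ)) :
    Measurable (density D F ε v) := by
  have hpot : Measurable fun x => F (v (D.param x)) :=
    (hF.comp (v.continuous.comp D.continuous_param)).measurable
  have hderiv : Measurable fun x => |deriv (fun x => v (D.param x)) x| :=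
    (measurable_deriv _).abs
  exact (((hderiv.pow_const 2).const_mul _).add (hpot.const_mul _)).ennreal_ofReal

lemma lipschitzWith_sum {ι X : Type*} [PseudoMetricSpace X] (I : Finset ι) {f : ι → X → ℝ}
    {L : ι → NNReal} (hf : ∀ k, LipschitzWith (L k) (f k)) :
    LipschitzWith (∑ k ∈ I, L k) fun x => ∑ k ∈ I, f k x :=
  LipschitzWith.of_dist_le_mul fun x y => by
    refine (dist_sum_sum_le_of_le I fun k _ => (hf k).dist_le_mul x y).trans_eq ?_
    rw [NNReal.coe_sum, Finset.sum_mul]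

variable {ι : Type*} {I : Finset ι} {c : ι → D.Pt} {τ : ι → ℝ}

/-- The function on `M` with bumps of heights `q (τ k)` at the points `c k` on the ground
level `1`. -/
noncomputable def multiBump (q : C(ℝ, ℝ)) (ε : ℝ) (I : Finset ι) (c : ι → D.Pt) (τ : ι → ℝ) :
    C(D.Pt, ℝ) :=
  1 + ∑ k ∈ I, (bump q ε (τ k) (c k) - 1)

lemma multiBump_apply (y : D.Pt) : multiBump q ε I c τ y =
    1 + ∑ k ∈ I, (bumpAt q (τ k) ε (dist y (c k)) - 1) := by
  simp [multiBump, bump_apply]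

lemma memH1_multiBump (hq : LipschitzWith K q) : MemH1 D (multiBump q ε I c τ) := by
  choose L hL using fun k => exists_lipschitzWith_bumpAt hq (τ k) ε
  have hbump (k : ι) : LipschitzWith (L k * 1 + 0) fun y => bumpAt q (τ k) ε (dist y (c k)) - 1 :=
    ((hL k).comp (LipschitzWith.dist_left (c k))).sub (LipschitzWith.const 1)
  refine memH1_of_lipschitzWith (K := 0 + ∑ k ∈ I, (L k * 1 + 0)) ?_
  have hfun : (multiBump q ε I c τ : D.Pt → ℝ) =
      fun y => 1 + ∑ k ∈ I, (bumpAt q (τ k) ε (dist y (c k)) - 1) := funext multiBump_apply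
  rw [hfun]
  exact (LipschitzWith.const (1 : ℝ)).add (lipschitzWith_sum I hbump)

lemma multiBump_eq_one (hq : IsProfile H q) (hε : 0 < ε) {y : D.Pt}
    (hy : ∀ j ∈ I, ε * |τ j| ≤ dist y (c j)) : multiBump q ε I c τ y = 1 := by
  rw [multiBump_apply, Finset.sum_eq_zero, add_zero]
  intro j hj
  rw [bumpAt_of_le hq hε (hy j hj), sub_self]

lemma multiBump_eq_bump (hq : IsProfile H q) (hε : 0 < ε) {y : D.Pt} {k : ι} (hk : k ∈ I)
    (hy : ∀ j ∈ I, j ≠ k → ε * |τ j| ≤ dist y (c j)) :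
    multiBump q ε I c τ y = bump q ε (τ k) (c k) y := by
  rw [multiBump_apply, Finset.sum_eq_single_of_mem k hk, add_sub_cancel, bump_apply]
  intro j hj hjk
  rw [bumpAt_of_le hq hε (hy j hj hjk), sub_self]

lemma lt_dist_of_pairwise (hsep : (I : Set ι).Pairwise fun k j =>
      ε * |τ k| + ε * |τ j| < dist (c k) (c j)) {y : D.Pt} {k : ι} (hk : k ∈ I)
    (hy : dist y (c k) ≤ ε * |τ k|) {j : ι} (hj : j ∈ I) (hjk : j ≠ k) :
    ε * |τ j| < dist y (c j) := by
  linarith [hsep hk hj hjk.symm, dist_triangle_left (c k) (c j) y]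

lemma density_congr {v w : C(D.Pt, ℝ)} {x : ℝ}
    (h : (fun t => v (D.param t)) =ᶠ[𝓝 x] fun t => w (D.param t)) :
    density D F ε v x = density D F ε w x := by
  rw [density, density, h.deriv_eq, h.eq_of_nhds]

lemma density_multiBump_le (hF1 : F 1 = 0) (hq : IsProfile H q) (hε : 0 < ε)
    (hsep : (I : Set ι).Pairwise fun k j => ε * |τ k| + ε * |τ j| < dist (c k) (c j)) (x : ℝ) :
    density D F ε (multiBump q ε I c τ) x ≤ ∑ k ∈ I, density D F ε (bump q ε (τ k) (c k)) x := by
  have hcont (j : ι) : ContinuousAt (fun t => dist (D.param t) (c j)) x :=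
    (D.continuous_param.dist continuous_const).continuousAt
  by_cases h : ∃ k ∈ I, dist (D.param x) (c k) ≤ ε * |τ k|
  · obtain ⟨k, hk, hxk⟩ := h
    have hfar : ∀ᶠ t in 𝓝 x, ∀ j ∈ I, j ≠ k → ε * |τ j| < dist (D.param t) (c j) :=
      (eventually_all_finset I).2 fun j hj => eventually_imp_distrib_left.2 fun hjk =>
        continuousAt_const.eventually_lt (hcont j) (lt_dist_of_pairwise hsep hk hxk hj hjk)
    have hloc : density D F ε (multiBump q ε I c τ) x = density D F ε (bump q ε (τ k) (c k)) x :=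
      density_congr (hfar.mono fun t ht =>
        multiBump_eq_bump hq hε hk fun j hj hjk => (ht j hj hjk).le)
    rw [hloc]
    exact Finset.single_le_sum (f := fun k => density D F ε (bump q ε (τ k) (c k)) x)
      (fun _ _ => zero_le) hk
  · push Not at h
    have hfar : ∀ᶠ t in 𝓝 x, ∀ j ∈ I, ε * |τ j| < dist (D.param t) (c j) :=
      (eventually_all_finset I).2 fun j hj =>
        continuousAt_const.eventually_lt (hcont j) (h j hj)
    have hloc : density D F ε (multiBump q ε I c τ) x = density D F ε 1 x :=
      density_congr (hfar.mono fun t ht => multiBump_eq_one hq hε fun j hj => (ht j hj).le)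
    rw [hloc]
    simp [density, hF1]

lemma ofReal_energy_multiBump_le (hF : CondF1 F) (hq : IsProfile H q) (hqK : LipschitzWith K q)
    (hH : Continuous H) (hH0 : ∀ y, 0 ≤ H y) (hε : 0 < ε)
    (hsep : (I : Set ι).Pairwise fun k j => ε * |τ k| + ε * |τ j| < dist (c k) (c j))
    (hFH : ∀ k ∈ I, ∀ y ∈ Set.uIcc 1 (q (τ k)), F y ≤ H y) :
    ENNReal.ofReal (energy D F ε (multiBump q ε I c τ)) ≤
      ∑ k ∈ I, ENNReal.ofReal ((2 - kappa D (c k)) * G H (q (τ k))) := by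
  have hF1 : F 1 = 0 := (hF.2.2 1).2 rfl
  rw [ofReal_energy hF.1 hF.2.1 hε (memH1_multiBump hqK)]
  calc ∫⁻ x in Set.Ioc D.left D.right, density D F ε (multiBump q ε I c τ) x
      ≤ ∫⁻ x in Set.Ioc D.left D.right, ∑ k ∈ I, density D F ε (bump q ε (τ k) (c k)) x :=
        lintegral_mono fun x => density_multiBump_le hF1 hq hε hsep x
    _ = ∑ k ∈ I, ∫⁻ x in Set.Ioc D.left D.right, density D F ε (bump q ε (τ k) (c k)) x :=
        lintegral_finsetSum _ fun k _ => measurable_density hF.1 ε _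
    _ ≤ _ := Finset.sum_le_sum fun k hk =>
        lintegral_density_bump_le hF1 hq hH hH0 hε (hFH k hk) (c k)

end MultiBump

section Recovery

variable {D : Domain} {F H : ℝ → ℝ} {q : C(ℝ, ℝ)} {ε : ℝ} {ι : Type*} {I : Finset ι}
  {c : ι → D.Pt} {τ : ι → ℝ} {Ξ : D.Pt → Set ℝ}

lemma multiBump_of_dist_le (hq : IsProfile H q) (hε : 0 < ε)
    (hsep : (I : Set ι).Pairwise fun k j => ε * |τ k| + ε * |τ j| < dist (c k) (c j)) {y : D.Pt}
    {k : ι} (hk : k ∈ I) (hy : dist y (c k) ≤ ε * |τ k|) :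
    multiBump q ε I c τ y = bumpAt q (τ k) ε (dist y (c k)) :=
  multiBump_eq_bump hq hε hk fun _ hj hjk => (lt_dist_of_pairwise hsep hk hy hj hjk).le

lemma multiBump_center (hq : IsProfile H q) (hε : 0 < ε)
    (hsep : (I : Set ι).Pairwise fun k j => ε * |τ k| + ε * |τ j| < dist (c k) (c j)) {k : ι}
    (hk : k ∈ I) : multiBump q ε I c τ (c k) = q (τ k) := by
  rw [multiBump_of_dist_le hq hε hsep hk (by rw [dist_self]; positivity), dist_self, bumpAt_zero]

lemma multiBump_eq_one_or_mem_uIcc (hq : IsProfile H q) (hε : 0 < ε)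
    (hsep : (I : Set ι).Pairwise fun k j => ε * |τ k| + ε * |τ j| < dist (c k) (c j)) (y : D.Pt) :
    multiBump q ε I c τ y = 1 ∨
      ∃ k ∈ I, dist y (c k) ≤ ε * |τ k| ∧ multiBump q ε I c τ y ∈ Set.uIcc 1 (q (τ k)) := by
  by_cases! h : ∃ k ∈ I, dist y (c k) ≤ ε * |τ k|
  · obtain ⟨k, hk, hy⟩ := h
    refine .inr ⟨k, hk, hy, ?_⟩
    rw [multiBump_of_dist_le hq hε hsep hk hy]
    exact bumpAt_mem_uIcc hq hε dist_nonneg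
  · exact .inl (multiBump_eq_one hq hε fun j hj => (h j hj).le)

lemma exists_multiBump_eq (hq : IsProfile H q) (hε : 0 < ε)
    (hsep : (I : Set ι).Pairwise fun k j => ε * |τ k| + ε * |τ j| < dist (c k) (c j)) {k : ι}
    (hk : k ∈ I) (hdist : ∀ d ∈ Set.Icc 0 (ε * |τ k|), ∃ y, dist y (c k) = d) {z : ℝ}
    (hz : z ∈ Set.uIcc 1 (q (τ k))) :
    ∃ y, dist y (c k) ≤ ε * |τ k| ∧ multiBump q ε I c τ y = z := by
  obtain ⟨d, hd, hdz⟩ := exists_bumpAt_eq hq hε hz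
  obtain ⟨y, rfl⟩ := hdist d hd
  exact ⟨y, hd.2, by rw [multiBump_of_dist_le hq hε hsep hk hd.2, hdz]⟩

lemma eventually_mul_lt (A : ℝ) {B : ℝ} (hB : 0 < B) : ∀ᶠ ε in 𝓝[>] (0 : ℝ), ε * A < B := by
  have hlim : Tendsto (fun ε : ℝ => ε * A) (𝓝[>] 0) (𝓝 0) := by
    simpa using ((continuous_mul_const A).tendsto 0).mono_left nhdsWithin_le_nhds
  exact hlim.eventually_lt_const hB

lemma eventually_pairwise_lt_dist (hc : Set.InjOn c I) (τ : ι → ℝ) :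
    ∀ᶠ ε in 𝓝[>] (0 : ℝ),
      (I : Set ι).Pairwise fun k j => ε * |τ k| + ε * |τ j| < dist (c k) (c j) := by
  refine (eventually_all_finset I).2 fun k hk => (eventually_all_finset I).2 fun j hj => ?_
  refine eventually_imp_distrib_left.2 fun hkj => ?_
  filter_upwards [eventually_mul_lt (|τ k| + |τ j|) (dist_pos.2 (hc.ne hk hj hkj))] with ε hε
  rwa [← mul_add]

lemma Domain.exists_dist_eq (D : Domain) :
    ∃ d₀ > 0, ∀ c : D.Pt, ∀ d ∈ Set.Icc 0 d₀, ∃ y, dist y c = d := by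
  cases D with
  | interval l r h =>
    refine ⟨(r - l) / 2, by linarith, fun c d hd => ?_⟩
    change ∃ y : Set.Icc l r, |(y : ℝ) - (c : Set.Icc l r).1| = d
    have hc := (c : Set.Icc l r).2
    rcases le_total (c : Set.Icc l r).1 ((l + r) / 2) with hm | hm
    · refine ⟨⟨(c : Set.Icc l r).1 + d, by linarith [hc.1, hd.1], by linarith [hd.2]⟩, ?_⟩
      rw [add_sub_cancel_left, abs_of_nonneg hd.1]
    · refine ⟨⟨(c : Set.Icc l r).1 - d, by linarith [hd.2], by linarith [hc.2, hd.1]⟩, ?_⟩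
      rw [sub_sub_cancel_left, abs_neg, abs_of_nonneg hd.1]
  | circle =>
    refine ⟨1 / 2, by norm_num, fun c d hd => ?_⟩
    obtain ⟨s, rfl⟩ := QuotientAddGroup.mk_surjective (c : UnitAddCircle)
    change ∃ y : UnitAddCircle, dist y (s : UnitAddCircle) = d
    have hd' : |d| ≤ |(1 : ℝ)| / 2 := by rw [abs_one, abs_of_nonneg hd.1]; exact hd.2
    refine ⟨(s + d : ℝ), ?_⟩
    rw [dist_eq_norm, ← AddCircle.coe_sub, add_sub_cancel_left,
      (AddCircle.norm_coe_eq_abs_iff 1 one_ne_zero).2 hd', abs_of_nonneg hd.1]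

lemma kappa_mem_Icc (D : Domain) (x : D.Pt) : kappa D x ∈ Set.Icc 0 1 :=
  ⟨Set.indicator_nonneg (fun _ _ => zero_le_one) x,
    Set.indicator_le_self' (fun _ _ => zero_le_one) x⟩

lemma sum_ofReal_le_sum_ofReal_add {f g : ι → ℝ} {δ : ℝ} (h : ∀ k ∈ I, f k ≤ g k + δ) :
    ∑ k ∈ I, ENNReal.ofReal (f k) ≤
      ∑ k ∈ I, ENNReal.ofReal (g k) + ENNReal.ofReal (I.card * δ) := by
  calc ∑ k ∈ I, ENNReal.ofReal (f k)
      ≤ ∑ k ∈ I, (ENNReal.ofReal (g k) + ENNReal.ofReal δ) := Finset.sum_le_sum fun k hk =>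
        (ENNReal.ofReal_le_ofReal (h k hk)).trans ENNReal.ofReal_add_le
    _ = _ := by
        rw [Finset.sum_add_distrib, Finset.sum_const, nsmul_eq_mul,
          ENNReal.ofReal_mul (Nat.cast_nonneg _), ENNReal.ofReal_natCast]

lemma sum_ofReal_mul_G_le {ξ : ι → ℝ} {η : ℝ} (hη : 0 ≤ η)
    (h : ∀ k ∈ I, G H (ξ k) ≤ G F (ξ k) + η / (2 * (I.card + 1))) :
    ∑ k ∈ I, ENNReal.ofReal ((2 - kappa D (c k)) * G H (ξ k)) ≤
      ∑ k ∈ I, ENNReal.ofReal ((2 - kappa D (c k)) * G F (ξ k)) + ENNReal.ofReal η := by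
  set δ := η / (2 * (I.card + 1)) with hδ
  have hterm : ∀ k ∈ I,
      (2 - kappa D (c k)) * G H (ξ k) ≤ (2 - kappa D (c k)) * G F (ξ k) + 2 * δ := fun k hk => by
    obtain ⟨hκ0, hκ1⟩ := kappa_mem_Icc D (c k)
    have hδ0 : 0 ≤ δ := by positivity
    nlinarith [mul_le_mul_of_nonneg_left (h k hk) (by linarith : 0 ≤ 2 - kappa D (c k))]
  have hsum : I.card * (2 * δ) ≤ η := by
    have : (I.card + 1) * (2 * δ) = η := by rw [hδ]; field_simp
    have hδ0 : 0 ≤ δ := by positivity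
    linarith
  exact (sum_ofReal_le_sum_ofReal_add hterm).trans (by gcongr)

lemma eventually_exists_bumps (hF : CondF1 F) (hc : Set.InjOn c I) (ξ : ι → ℝ) {η : ℝ}
    (hη : 0 < η) : ∀ᶠ ε in 𝓝[>] (0 : ℝ), ∃ w : C(D.Pt, ℝ), MemH1 D w ∧
      (∀ y, w y = 1 ∨ ∃ k ∈ I, dist y (c k) < η ∧ w y ∈ Set.uIcc 1 (ξ k)) ∧
      (∀ k ∈ I, ∀ z ∈ Set.uIcc 1 (ξ k), ∃ y, dist y (c k) < η ∧ w y = z) ∧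
      (∀ k ∈ I, w (c k) = ξ k) ∧
      ENNReal.ofReal (energy D F ε w) ≤
        ∑ k ∈ I, ENNReal.ofReal ((2 - kappa D (c k)) * G F (ξ k)) + ENNReal.ofReal η := by
  have hbound : ∀ k ∈ I, |ξ k| ≤ 1 + ∑ k ∈ I, |ξ k| := fun k hk =>
    (Finset.single_le_sum (f := fun k => |ξ k|) (fun _ _ => abs_nonneg _) hk).trans (by simp)
  obtain ⟨H, q, K, hH, hH0, hq, hqK, hHF⟩ := exists_isProfile_above hF.1 hF.2.1
    (R := 1 + ∑ k ∈ I, |ξ k|) (le_add_of_nonneg_right (Finset.sum_nonneg fun _ _ => abs_nonneg _))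
    (η := η / (2 * (I.card + 1))) (by positivity)
  choose τ hτ using fun k => hq.surjective (ξ k)
  obtain ⟨d₀, hd₀, hdist⟩ := D.exists_dist_eq
  have hsmall : ∀ᶠ ε in 𝓝[>] (0 : ℝ), ∀ k ∈ I, ε * |τ k| < min η d₀ :=
    (eventually_all_finset I).2 fun k _ => eventually_mul_lt _ (lt_min hη hd₀)
  filter_upwards [hsmall, eventually_pairwise_lt_dist hc τ, self_mem_nhdsWithin]
    with ε hsmall hsep hε
  have hltη {k : ι} (hk : k ∈ I) : ε * |τ k| < η := (hsmall k hk).trans_le (min_le_left _ _)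
  simp_rw [← hτ] at hHF hbound ⊢
  refine ⟨multiBump q ε I c τ, memH1_multiBump hqK, fun y => ?_, fun k hk z hz => ?_,
    fun k hk => multiBump_center hq hε hsep hk, ?_⟩
  · exact (multiBump_eq_one_or_mem_uIcc hq hε hsep y).imp_right
      fun ⟨k, hk, hy, hmem⟩ => ⟨k, hk, hy.trans_lt (hltη hk), hmem⟩
  · obtain ⟨y, hy, hyz⟩ := exists_multiBump_eq hq hε hsep hk
      (fun d hd => hdist (c k) d ⟨hd.1, hd.2.trans ((hsmall k hk).le.trans (min_le_right _ _))⟩) hz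
    exact ⟨y, hy.trans_lt (hltη hk), hyz⟩
  · exact (ofReal_energy_multiBump_le hF hq hqK hH hH0 hε hsep fun k hk =>
      (hHF _ (hbound k hk)).1).trans (sum_ofReal_mul_G_le hη.le fun k hk => (hHF _ (hbound k hk)).2)

lemma Domain.finite_boundary (D : Domain) : D.boundary.Finite := by
  cases D with
  | interval l r h =>
    refine (Set.toFinite {(⟨l, le_rfl, h.le⟩ : Set.Icc l r), ⟨r, h.le, le_rfl⟩}).subset ?_
    rintro x (hx | hx)
    · exact .inl (Subtype.ext hx)
    · exact .inr (Subtype.ext hx)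
  | circle => exact Set.finite_empty

lemma Domain.infinite_ball (D : Domain) (x : D.Pt) {ρ : ℝ} (hρ : 0 < ρ) :
    (Metric.ball x ρ).Infinite := by
  obtain ⟨d₀, hd₀, hdist⟩ := D.exists_dist_eq
  refine Set.Infinite.of_image (dist · x) ((Set.Ioo_infinite (lt_min hd₀ hρ)).mono fun d hd => ?_)
  obtain ⟨y, rfl⟩ := hdist x d ⟨hd.1.le, hd.2.le.trans (min_le_left _ _)⟩
  exact ⟨y, hd.2.trans_le (min_le_right _ _), rfl⟩

lemma exists_injOn_dist_lt {X : Type*} [PseudoMetricSpace X] {ρ : ℝ}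
    (hX : ∀ x : X, (Metric.ball x ρ).Infinite) (S : Finset X) {T : Set X} (hT : T.Finite) :
    ∃ σ : X → X, Set.InjOn σ S ∧ ∀ x ∈ S, σ x ∉ T ∧ dist (σ x) x < ρ := by
  classical
  induction S using Finset.induction_on with
  | empty => exact ⟨id, by simp, by simp⟩
  | insert x S hx ih =>
    obtain ⟨σ, hinj, hσ⟩ := ih
    obtain ⟨y, hy, hyT⟩ :=
      (hX x).exists_notMem_finite (hT.union (S.finite_toSet.image σ))
    rw [Set.mem_union, not_or] at hyT
    have heq : Set.EqOn (Function.update σ x y) σ S := fun z hz =>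
      Function.update_of_ne (fun h : z = x => hx (h ▸ hz)) _ _
    refine ⟨Function.update σ x y, ?_, (Finset.forall_mem_insert _ _ _).2 ⟨?_, fun z hz => ?_⟩⟩
    · rw [Finset.coe_insert, Set.injOn_insert (mod_cast hx), heq.injOn_iff, heq.image_eq,
        Function.update_self]
      exact ⟨hinj, hyT.2⟩
    · rw [Function.update_self]
      exact ⟨hyT.1, hy⟩
    · rw [heq hz]
      exact hσ z hz

-- One half of `Ξ x` is reached by a bump at `x`, the other one by a bump nearby. At a boundary
-- point the bump at `x` costs only half, so it should reach the more expensive end.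
lemma exists_uIcc_union_uIcc_eq (F : ℝ → ℝ) (hΞ : Ξ ∈ classA₀ D.Pt) (x : D.Pt) :
    ∃ p r : ℝ, Set.uIcc 1 p ∪ Set.uIcc 1 r = Ξ x ∧
      (2 - kappa D x) * G F p + 2 * G F r = jumpCost D F Ξ x ∧
      (x ∉ D.boundary → p = sInf (Ξ x)) := by
  have hunion : Set.uIcc 1 (sInf (Ξ x)) ∪ Set.uIcc 1 (sSup (Ξ x)) = Ξ x := by
    rw [Set.uIcc_of_ge (sInf_le_one hΞ x), Set.uIcc_of_le (one_le_sSup hΞ x),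
      Set.Icc_union_Icc_eq_Icc (sInf_le_one hΞ x) (one_le_sSup hΞ x),
      ← eq_Icc_of_mem_classA₀ hΞ x]
  by_cases hx : x ∈ D.boundary
  · have hκ : kappa D x = 1 := Set.indicator_of_mem hx _
    rw [jumpCost, hκ]
    rcases le_total (G F (sInf (Ξ x))) (G F (sSup (Ξ x))) with h | h
    · refine ⟨_, _, Set.union_comm _ _ ▸ hunion, ?_, absurd hx⟩
      rw [max_eq_right h]
      ring
    · refine ⟨_, _, hunion, ?_, absurd hx⟩
      rw [max_eq_left h]
      ring
  · refine ⟨_, _, hunion, ?_, fun _ => rfl⟩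
    rw [jumpCost, kappa, Set.indicator_of_notMem hx]
    ring

lemma sum_disjSum_le_limitEnergy (hΞ : Ξ ∈ classA₀ D.Pt) {S : Finset D.Pt} {σ : D.Pt → D.Pt}
    {p r : D.Pt → ℝ} (hσ : ∀ x ∈ S, σ x ∉ D.boundary)
    (hcost : ∀ x ∈ S, (2 - kappa D x) * G F (p x) + 2 * G F (r x) ≤ jumpCost D F Ξ x) :
    ∑ k ∈ S.disjSum S, ENNReal.ofReal
      ((2 - kappa D (Sum.elim id σ k)) * G F (Sum.elim p r k)) ≤ limitEnergy D F Ξ := by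
  rw [Finset.sum_disjSum, ← Finset.sum_add_distrib, limitEnergy_eq_tsum F hΞ]
  refine (Finset.sum_le_sum fun x hx => ?_).trans (ENNReal.sum_le_tsum S)
  have hκσ : kappa D (σ x) = 0 := Set.indicator_of_notMem (hσ x hx) _
  have hκ : 0 ≤ 2 - kappa D x := by linarith [(kappa_mem_Icc D x).2]
  simp only [Sum.elim_inl, Sum.elim_inr, id, hκσ, sub_zero]
  rw [← ENNReal.ofReal_add (mul_nonneg hκ (G_nonneg F _)) (mul_nonneg zero_le_two (G_nonneg F _))]
  exact ENNReal.ofReal_le_ofReal (hcost x hx)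

lemma eventually_exists_near_finite (hF : CondF1 F) (hΞ : Ξ ∈ classA₀ D.Pt) (S : Finset D.Pt)
    {η : ℝ} (hη : 0 < η) : ∀ᶠ ε in 𝓝[>] (0 : ℝ), ∃ w : C(D.Pt, ℝ), MemH1 D w ∧
      (∀ y, ∃ x, dist y x < η ∧ w y ∈ Ξ x) ∧
      (∀ x ∈ S, ∀ z ∈ Ξ x, ∃ y, dist y x < η ∧ w y = z) ∧
      (∀ x ∈ S, x ∉ D.boundary → w x = sInf (Ξ x)) ∧
      ENNReal.ofReal (energy D F ε w) ≤ limitEnergy D F Ξ + ENNReal.ofReal η := by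
  choose p r hpr hcost hp using exists_uIcc_union_uIcc_eq F hΞ
  obtain ⟨σ, hσ_inj, hσ⟩ := exists_injOn_dist_lt (fun x => D.infinite_ball x (half_pos hη)) S
    (S.finite_toSet.union D.finite_boundary)
  have hcinj : Set.InjOn (Sum.elim id σ) (S.disjSum S : Finset (D.Pt ⊕ D.Pt)) :=
    (Set.InjOn.sumElim (s := (↑S, ↑S)) (Set.injOn_id _) hσ_inj fun x hx y hy hxy =>
      (hσ y hy).1 (.inl (hxy ▸ hx))).mono fun k hk => by
        simpa [Set.sumEquiv, Finset.mem_disjSum] using hk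
  have hsub (x : D.Pt) : Set.uIcc 1 (p x) ⊆ Ξ x ∧ Set.uIcc 1 (r x) ⊆ Ξ x :=
    Set.union_subset_iff.1 (hpr x).subset
  filter_upwards [eventually_exists_bumps hF hcinj (Sum.elim p r) (half_pos hη)]
    with ε ⟨w, hw, hnear, hatt, hcenter, hE⟩
  refine ⟨w, hw, fun y => ?_, fun x hx z hz => ?_, fun x hx hxb => ?_, ?_⟩
  · obtain h | ⟨x | x, hx, hd, hm⟩ := hnear y
    · exact ⟨y, by rwa [dist_self], h ▸ one_mem_of_mem_classA₀ hΞ y⟩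
    · exact ⟨x, hd.trans (half_lt_self hη), (hsub x).1 hm⟩
    · refine ⟨x, ?_, (hsub x).2 hm⟩
      exact (dist_triangle y (σ x) x).trans_lt
        ((add_lt_add hd (hσ x (Finset.inr_mem_disjSum.1 hx)).2).trans_eq (add_halves η))
  · rcases (hpr x).superset hz with hz | hz
    · obtain ⟨y, hy, rfl⟩ := hatt (.inl x) (Finset.inl_mem_disjSum.2 hx) z hz
      exact ⟨y, hy.trans (half_lt_self hη), rfl⟩
    · obtain ⟨y, hy, rfl⟩ := hatt (.inr x) (Finset.inr_mem_disjSum.2 hx) z hz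
      refine ⟨y, ?_, rfl⟩
      exact (dist_triangle y (σ x) x).trans_lt
        ((add_lt_add hy (hσ x hx).2).trans_eq (add_halves η))
  · exact (hcenter (.inl x) (Finset.inl_mem_disjSum.2 hx)).trans (hp x hxb)
  · exact hE.trans (add_le_add (sum_disjSum_le_limitEnergy hΞ
      (fun x hx h => (hσ x hx).1 (.inr h)) fun x _ => (hcost x).le)
      (ENNReal.ofReal_le_ofReal (half_le_self hη.le)))

lemma eventually_exists_recovery (hF : CondF1 F) (hΞ : Ξ ∈ classA₀ D.Pt) {a : D.Pt}
    (ha : a ∉ D.boundary) {η : ℝ} (hη : 0 < η) :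
    ∀ᶠ ε in 𝓝[>] (0 : ℝ), ∃ w : C(D.Pt, ℝ), MemH1 D w ∧ GraphsNear η w Ξ ∧ w a = sInf (Ξ a) ∧
      ENNReal.ofReal (energy D F ε w) ≤ limitEnergy D F Ξ + ENNReal.ofReal η := by
  classical
  obtain ⟨N, hN, hNfin, hcover⟩ :=
    (isCompact_setOf_mem_of_mem_classB hΞ.1.1).finite_cover_balls (half_pos hη)
  filter_upwards [eventually_exists_near_finite hF hΞ (insert a (hNfin.toFinset.image Prod.fst))
    (half_pos hη)] with ε ⟨w, hw, hnear, hatt, hinf, hE⟩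
  refine ⟨w, hw, ⟨fun y => ?_, fun x z hz => ?_⟩, hinf a (Finset.mem_insert_self _ _) ha,
    hE.trans (by gcongr; exact half_le_self hη.le)⟩
  · obtain ⟨x, hx, hm⟩ := hnear y
    exact ⟨x, w y, hm, hx.trans (half_lt_self hη), by rwa [dist_self]⟩
  · obtain ⟨n, hn, hzn⟩ := Set.mem_iUnion₂.1 (hcover (show (x, z) ∈ _ from hz))
    have hnS : n.1 ∈ insert a (hNfin.toFinset.image Prod.fst) := Finset.mem_insert_of_mem
      (Finset.mem_image_of_mem _ (hNfin.mem_toFinset.2 hn))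
    obtain ⟨y, hy, hyn⟩ := hatt n.1 hnS n.2 (hN hn)
    rw [Metric.mem_ball, Prod.dist_eq, max_lt_iff] at hzn
    refine ⟨y, ?_, ?_⟩
    · linarith [dist_triangle_right y x n.1]
    · rw [hyn, dist_comm]
      exact hzn.2.trans (half_lt_self hη)

lemma exists_recovery (hF : CondF1 F) (hΞ : Ξ ∈ classA₀ D.Pt) {a : D.Pt} (ha : a ∉ D.boundary) :
    ∃ w : ℝ → C(D.Pt, ℝ), (∀ ε, MemH1 D (w ε)) ∧ (∀ ε, w ε a = sInf (Ξ a)) ∧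
      GraphTendsto w Ξ ∧ Tendsto (fun ε => ENNReal.ofReal (energy D F ε (w ε))) (𝓝[>] 0)
        (𝓝 (limitEnergy D F Ξ)) := by
  have : Nonempty {w : C(D.Pt, ℝ) // MemH1 D w ∧ w a = sInf (Ξ a)} := by
    obtain ⟨ε, w, hw, -, hwa, -⟩ := (eventually_exists_recovery hF hΞ ha one_pos).exists
    exact ⟨w, hw, hwa⟩
  obtain ⟨w, hlim⟩ := exists_tendsto_zero_of_forall_eventually
    (f := fun ε (w : {w : C(D.Pt, ℝ) // MemH1 D w ∧ w a = sInf (Ξ a)}) =>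
      max (Metric.hausdorffEDist (graph (single w.1)) (graph Ξ))
        (ENNReal.ofReal (energy D F ε w.1) - limitEnergy D F Ξ)) fun δ hδ => by
      obtain ⟨η, hη, hηδ⟩ := ENNReal.lt_iff_exists_nnreal_btwn.1 hδ
      have hη0 : (0 : ℝ) < η := by simpa using hη
      filter_upwards [eventually_exists_recovery hF hΞ ha (half_pos hη0)]
        with ε ⟨w, hw, hnear, hwa, hE⟩
      refine ⟨⟨w, hw, hwa⟩, max_le (hnear.hausdorffEDist_le.trans ?_)
        ((tsub_le_iff_left.2 hE).trans ?_)⟩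
      · simpa [mul_div_cancel₀] using hηδ.le
      · exact ((ENNReal.ofReal_le_ofReal (half_le_self hη0.le)).trans_eq
          ENNReal.ofReal_coe_nnreal).trans hηδ.le
  have hgraph : GraphTendsto (fun ε => (w ε).1) Ξ :=
    tendsto_of_tendsto_of_tendsto_of_le_of_le tendsto_const_nhds hlim (fun _ => zero_le)
      fun _ => le_max_left _ _
  have hexcess : Tendsto (fun ε => limitEnergy D F Ξ +
      (ENNReal.ofReal (energy D F ε (w ε).1) - limitEnergy D F Ξ)) (𝓝[>] 0)
      (𝓝 (limitEnergy D F Ξ)) := by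
    simpa using (tendsto_const_nhds (x := limitEnergy D F Ξ)).add
      (tendsto_of_tendsto_of_tendsto_of_le_of_le tendsto_const_nhds hlim (fun _ => zero_le)
        fun _ => le_max_right _ _)
  refine ⟨fun ε => (w ε).1, fun ε => (w ε).2.1, fun ε => (w ε).2.2, hgraph,
    tendsto_of_le_liminf_of_limsup_le ?_ ?_⟩
  · exact limitEnergy_le_liminf hF (.of_forall fun ε => (w ε).2.1) hgraph hΞ.1.1
  · exact (limsup_le_limsup (.of_forall fun _ => le_add_tsub)).trans_eq hexcess.limsup_eq

end Recovery

end SMM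

open SMM Filter Topology in
theorem theorem2p1_general (D : Domain) (F : ℝ → ℝ) (hF1 : CondF1 F)
    (a : D.Pt) (ha : a ∉ D.boundary) (b : ℝ) (hb : 0 ≤ b) :
    (∀ (v : ℝ → C(D.Pt, ℝ)) (Ξ : D.Pt → Set ℝ),
      (∀ ε ∈ Set.Ioo (0 : ℝ) 1, MemH1 D (v ε)) → Ξ ∈ classB D.Pt → GraphTendsto v Ξ →
        ((b = 0 ∨ 0 ≤ sInf (Ξ a)) →
          limitEnergyB D F a b Ξ ≤
            liminf (fun ε => ENNReal.ofReal (energyB D F a b ε (v ε))) (𝓝[>] 0)) ∧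
        (liminf (fun ε => ENNReal.ofReal (energyB D F a b ε (v ε))) (𝓝[>] 0) < ⊤ →
          Ξ ∈ classA₀ D.Pt)) ∧
    (∀ Ξ ∈ classA₀ D.Pt, ∃ w : ℝ → C(D.Pt, ℝ),
      (∀ ε ∈ Set.Ioo (0 : ℝ) 1, MemH1 D (w ε)) ∧ GraphTendsto w Ξ ∧
        Tendsto (fun ε => ENNReal.ofReal (energyB D F a b ε (w ε))) (𝓝[>] 0)
          (𝓝 (limitEnergyB D F a b Ξ))) := by
  refine ⟨fun v Ξ hv hΞ h => ?_, fun Ξ hΞ => ?_⟩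
  · have hv : ∀ᶠ ε in 𝓝[>] 0, MemH1 D (v ε) := mem_of_superset (Ioo_mem_nhdsGT one_pos) hv
    refine ⟨limitEnergyB_le_liminf hF1 hb hv h hΞ, fun hfin => ?_⟩
    have hle : liminf (fun ε => ENNReal.ofReal (energy D F ε (v ε))) (𝓝[>] 0) ≤
        liminf (fun ε => ENNReal.ofReal (energyB D F a b ε (v ε))) (𝓝[>] 0) :=
      liminf_le_liminf (.of_forall fun ε =>
        ENNReal.ofReal_le_ofReal (energy_le_energyB hb a ε (v ε)))
    exact mem_classA₀_of_liminf_energy_lt_top hF1 hv h hΞ (hle.trans_lt hfin)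
  · obtain ⟨w, hw, hwa, hgraph, hE⟩ := exists_recovery hF1 hΞ ha
    refine ⟨w, fun ε _ => hw ε, hgraph, (hE.add tendsto_const_nhds).congr' ?_⟩
    filter_upwards [self_mem_nhdsWithin] with ε hε
    rw [ofReal_energyB hF1.2.1 hε hb, hwa]

open SMM Filter Topology in
theorem theorem2p1 (D : Domain) (F : ℝ → ℝ) (hF1 : CondF1 F) (hF2 : CondF2 F)
    (a : D.Pt) (ha : a ∉ D.boundary) (b : ℝ) (hb : 0 ≤ b) :
    -- liminf inequality, and the limit lies in `𝓐₀` if the liminf is finite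
    (∀ (v : ℝ → C(D.Pt, ℝ)) (Ξ : D.Pt → Set ℝ),
      (∀ ε ∈ Set.Ioo (0 : ℝ) 1, MemH1 D (v ε)) → Ξ ∈ classB D.Pt → GraphTendsto v Ξ →
        ((b = 0 ∨ 0 ≤ sInf (Ξ a)) →
          limitEnergyB D F a b Ξ ≤
            liminf (fun ε => ENNReal.ofReal (energyB D F a b ε (v ε))) (𝓝[>] 0)) ∧
        (liminf (fun ε => ENNReal.ofReal (energyB D F a b ε (v ε))) (𝓝[>] 0) < ⊤ →
          Ξ ∈ classA₀ D.Pt)) ∧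
    -- existence of recovery families
    (∀ Ξ ∈ classA₀ D.Pt, ∃ w : ℝ → C(D.Pt, ℝ),
      (∀ ε ∈ Set.Ioo (0 : ℝ) 1, MemH1 D (w ε)) ∧ GraphTendsto w Ξ ∧
        Tendsto (fun ε => ENNReal.ofReal (energyB D F a b ε (w ε))) (𝓝[>] 0)
          (𝓝 (limitEnergyB D F a b Ξ))) :=
  theorem2p1_general D F hF1 a ha b hb
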